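/- For $f,u\in L^2_{\rm loc}(\mathbb R^3;\mathbb C)$ put $$\|f\|_{B}=\sum_{j\ge -1}\Big(2^{j+1}\int_{C(j)}|f|^2\,dx\Big)^{1/2},\qquad \|u\|_{B^*}=\sup_{j\ge -1}\Big(2^{-j}\int_{C(j)}|u|^2\,dx\Big)^{1/2},$$ where $C(-1)$ is the unit ball and $C(j)=\{x\in\mathbb R^3: 2^j\le|x|<2^{j+1}\}$ for $j\ge0$; let $B$ be the set of (measurable) $f$ with $\|f\|_B<\infty$. Let $q_1\in\mathbb R^3\setminus\{0\}$. There is a constant $C$, depending only on $q_1$, such that the following holds. Let $\alpha_\varepsilon>0$ for every $\varepsilon>0$, and let $S_0,S_1\in B$. Then for every $\varepsilon>0$ the Helmholtz equation $$-i\frac{\alpha_\varepsilon}{\varepsilon}u^\varepsilon+\Delta u^\varepsilon+\frac{1}{\varepsilon^2}u^\varepsilon=\frac1{\varepsilon^3}S_0\Big(\frac x\varepsilon\Big)+\frac1{\varepsilon^3}S_1\Big(\frac{x-q_1}\varepsilon\Big)\qquad\text{in }\mathbb R^3$$ (in the sense of tempered distributions) has exactly one solution $u^\varepsilon\in L^2(\mathbb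 R^3)$, and it satisfies $$\|u^\varepsilon\|_{B^*}\le C\big(\|S_0\|_B+\|S_1\|_B\big).$$ In particular $C$ is independent of $\varepsilon$ (and of $\alpha_\varepsilon$, $S_0$, $S_1$). -/

import Mathlib

open MeasureTheory
open scoped ENNReal NNReal SchwartzMap Laplacian

noncomputable section

/-- Euclidean space of dimension three. -/
abbrev R3 : Type := EuclideanSpace ℝ (Fin 3)

/-- The dyadic rings, with the index shifted by one so that it is a natural number:
`dyadicRing 0` is the unit ball `C(-1)` and `dyadicRing (j + 1)` is `C(j) = {2^j ≤ |x| < 2^(j+1)}`. -/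
def dyadicRing : ℕ → Set R3
  | 0 => Metric.ball 0 1
  | j + 1 => {x | 2 ^ j ≤ ‖x‖ ∧ ‖x‖ < 2 ^ (j + 1)}

/-- The norm `‖f‖_B = ∑_{j ≥ -1} (2^(j+1) ∫_{C(j)} |f|²)^(1/2)`, with values in `[0, ∞]`
(here `k = j + 1`). -/
def bNorm (f : R3 → ℂ) : ℝ≥0∞ :=
  ∑' k : ℕ, (2 ^ k * ∫⁻ x in dyadicRing k, ‖f x‖ₑ ^ 2) ^ (1 / 2 : ℝ)

/-- The norm `‖u‖_{B*} = sup_{j ≥ -1} (2^(-j) ∫_{C(j)} |u|²)^(1/2)`, with values in `[0, ∞]`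
(here `k = j + 1`). -/
def bStarNorm (u : R3 → ℂ) : ℝ≥0∞ :=
  ⨆ k : ℕ, ((2 : ℝ≥0∞) ^ (1 - (k : ℤ)) * ∫⁻ x in dyadicRing k, ‖u x‖ₑ ^ 2) ^ (1 / 2 : ℝ)

/-- Membership in the space `B`. -/
structure MemB (f : R3 → ℂ) : Prop where
  aestronglyMeasurable : AEStronglyMeasurable f volume
  bNorm_lt_top : bNorm f < ∞

/-- The source `S^ε(x) = ε⁻³ S₀(x/ε) + ε⁻³ S₁((x - q₁)/ε)`. -/
def twoPointSource (S₀ S₁ : R3 → ℂ) (q₁ : R3) (ε : ℝ) (x : R3) : ℂ :=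
  ((1 / ε ^ 3 : ℝ) : ℂ) * S₀ (ε⁻¹ • x) + ((1 / ε ^ 3 : ℝ) : ℂ) * S₁ (ε⁻¹ • (x - q₁))

/-- `u ∈ L²(ℝ³)` solves `-i (a/ε) u + Δu + u/ε² = S` in the sense of tempered distributions. -/
def IsHelmholtzSolution (ε a : ℝ) (S : R3 → ℂ) (u : Lp ℂ 2 (volume : Measure R3)) : Prop :=
  ∀ φ : 𝓢(R3, ℂ),
    (-(Complex.I * ((a / ε : ℝ) : ℂ)) • (u : 𝓢'(R3, ℂ)) + Δ (u : 𝓢'(R3, ℂ))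
      + ((1 / ε ^ 2 : ℝ) : ℂ) • (u : 𝓢'(R3, ℂ))) φ = ∫ x, φ x * S x

end

open scoped LineDeriv
open Filter Topology

/-! The substitution `y = (x - q) / ε` around a source turns the equation into `Δw + (1 - i a) w =
f` with `a = α_ε ε`; linearity lets the two sources be treated separately. At unit wave number the
key is a limiting absorption estimate `∫_{|x|<R} |w|² ≤ c R ‖f‖_B²`, uniform in `a > 0` and valid
for every `R > 0`. This bound is invariant under the rescaling, so no `ε` survives; small radii are
needed because `ε` may be large. Recentring a ball of radius `2^k ≥ 1` at `q₁` costs at most the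
factor `1 + ‖q₁‖` in the radius.

For Schwartz `w` the estimate is a multiplier argument. Testing with `(x·∇w + w) / √(R² + |x|²)`
(`integral_virial`) produces a form that dominates `R² (R² + |x|²)^(-3/2) (|w|² + |∇w|²)`, a weight
of size `1/R` on the ball of radius `R`. The absorption leaves a term `a ∫ |w||∇w|`, controlled by
testing with `w` itself (`SchwartzMap.flux_bound`). What remains is `∫ |f| (|w|² + |∇w|²)^(1/2)`, at
most `‖f‖_B X` by `B`–`B*` duality, where `X²` is the supremum of the normalized energies on dyadic
balls. The resulting quadratic inequality in `X` closes
(`SchwartzMap.setIntegral_normSq_le_of_bNorm_le`). Radii below one come from a Hardy-type inequality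
(`integral_mul_sq_le_of_le_one`).

Since `Im z ≠ 0`, the Fourier multiplier inverting `Δ + z` preserves Schwartz space
(`SchwartzMap.exists_helmholtz_eq`). Duality then gives uniqueness, and density of Schwartz
functions together with an `L²` bound gives existence. -/

/-! ### The radial weight and its derivatives -/

/-- The standard basis vectors of `R3`. -/
noncomputable def basisVec (j : Fin 3) : R3 := EuclideanSpace.single j 1

/-- The weight `(R² + |x|²)^(-1/2)`. -/
noncomputable def invBracket (R : ℝ) (x : R3) : ℝ := (√(R ^ 2 + ‖x‖ ^ 2))⁻¹

theorem invBracket_pos {R : ℝ} (hR : 0 < R) (x : R3) : 0 < invBracket R x := by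
  unfold invBracket; positivity

theorem invBracket_sq {R : ℝ} (hR : 0 < R) (x : R3) :
    invBracket R x ^ 2 * (R ^ 2 + ‖x‖ ^ 2) = 1 := by
  unfold invBracket
  rw [inv_pow, Real.sq_sqrt (by positivity)]
  exact inv_mul_cancel₀ (by positivity)

theorem norm_mul_invBracket_le {R : ℝ} (hR : 0 < R) (x : R3) : ‖x‖ * invBracket R x ≤ 1 := by
  have h := invBracket_sq hR x
  have h0 := invBracket_pos hR x
  refine abs_le_one_iff_mul_self_le_one.2 ?_ |> le_of_abs_le
  nlinarith [mul_pos h0 h0, sq_nonneg R, mul_nonneg (sq_nonneg (invBracket R x)) (sq_nonneg R)]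

theorem mul_invBracket_le {R : ℝ} (hR : 0 < R) (x : R3) : R * invBracket R x ≤ 1 := by
  have h := invBracket_sq hR x
  have h0 := invBracket_pos hR x
  refine abs_le_one_iff_mul_self_le_one.2 ?_ |> le_of_abs_le
  nlinarith [mul_nonneg (sq_nonneg (invBracket R x)) (sq_nonneg ‖x‖)]

theorem le_mul_invBracket {R : ℝ} (hR : 0 < R) {x : R3} (hx : ‖x‖ ≤ R) :
    1 ≤ 2 * (R * invBracket R x) ^ 2 := by
  have h := invBracket_sq hR x
  have h2 : ‖x‖ ^ 2 ≤ R ^ 2 := by gcongr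
  nlinarith [mul_le_mul_of_nonneg_left h2 (sq_nonneg (invBracket R x))]

theorem norm_sq_eq_coord (x : R3) : ‖x‖ ^ 2 = x 0 ^ 2 + x 1 ^ 2 + x 2 ^ 2 := by
  rw [EuclideanSpace.norm_sq_eq, Fin.sum_univ_three]
  simp

theorem hasTemperateGrowth_invBracket {R : ℝ} (hR : 0 < R) :
    (invBracket R).HasTemperateGrowth := by
  have : invBracket R = fun x : R3 ↦ R⁻¹ * (fun y : R3 ↦ (1 + ‖y‖ ^ 2) ^ (-1 / 2 : ℝ)) (R⁻¹ • x) := by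
    ext x
    have h1 : R ^ 2 + ‖x‖ ^ 2 = R ^ 2 * (1 + ‖R⁻¹ • x‖ ^ 2) := by
      rw [norm_smul, mul_pow, Real.norm_of_nonneg (by positivity)]
      field_simp
    simp only [invBracket]
    rw [h1, Real.sqrt_mul (by positivity), Real.sqrt_sq hR.le, mul_inv, Real.sqrt_eq_rpow,
      ← Real.rpow_neg (by positivity)]
    norm_num
  rw [this]
  have h1 := Function.hasTemperateGrowth_one_add_norm_sq_rpow R3 (-1 / 2 : ℝ)
  have h2 : (fun x : R3 ↦ R⁻¹ • x).HasTemperateGrowth :=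
    (R⁻¹ • ContinuousLinearMap.id ℝ R3).hasTemperateGrowth
  exact (Function.HasTemperateGrowth.const R⁻¹).mul (h1.comp h2)

theorem hasTemperateGrowth_coord (k : Fin 3) : (fun x : R3 ↦ x k).HasTemperateGrowth :=
  (EuclideanSpace.proj (𝕜 := ℝ) k : R3 →L[ℝ] ℝ).hasTemperateGrowth

theorem HasLineDerivAt.fun_mul {f g : R3 → ℝ} {f' g' : ℝ} {x v : R3}
    (hf : HasLineDerivAt ℝ f f' x v) (hg : HasLineDerivAt ℝ g g' x v) :
    HasLineDerivAt ℝ (fun y ↦ f y * g y) (f' * g x + f x * g') x v := by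
  unfold HasLineDerivAt at *
  convert! HasDerivAt.mul hf hg using 1
  simp

theorem HasLineDerivAt.fun_add' {f g : R3 → ℝ} {f' g' : ℝ} {x v : R3}
    (hf : HasLineDerivAt ℝ f f' x v) (hg : HasLineDerivAt ℝ g g' x v) :
    HasLineDerivAt ℝ (fun y ↦ f y + g y) (f' + g') x v :=
  HasDerivAt.add hf hg

theorem HasLineDerivAt.fun_const_mul {f : R3 → ℝ} {f' : ℝ} {x v : R3} (c : ℝ)
    (hf : HasLineDerivAt ℝ f f' x v) :
    HasLineDerivAt ℝ (fun y ↦ c * f y) (c * f') x v :=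
  HasDerivAt.const_mul c hf

theorem HasLineDerivAt.fun_pow {f : R3 → ℝ} {f' : ℝ} {x v : R3} (n : ℕ)
    (hf : HasLineDerivAt ℝ f f' x v) :
    HasLineDerivAt ℝ (fun y ↦ f y ^ n) (n * f x ^ (n - 1) * f') x v := by
  unfold HasLineDerivAt at *
  convert! HasDerivAt.pow hf n using 1
  simp

theorem SchwartzMap.hasLineDerivAt (u : 𝓢(R3, ℝ)) (x v : R3) :
    HasLineDerivAt ℝ u (∂_{v} u x) x v := by
  rw [SchwartzMap.lineDerivOp_apply]
  exact (u.differentiableAt.lineDifferentiableAt).hasLineDerivAt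

theorem hasLineDerivAt_coord (k j : Fin 3) (x : R3) :
    HasLineDerivAt ℝ (fun y : R3 ↦ y k) (if k = j then 1 else 0) x (basisVec j) := by
  have h := ((EuclideanSpace.proj (𝕜 := ℝ) k : R3 →L[ℝ] ℝ).hasFDerivAt (x := x)).hasLineDerivAt
    (basisVec j)
  convert! h using 1
  simp [basisVec]

theorem hasLineDerivAt_invBracket {R : ℝ} (hR : 0 < R) (j : Fin 3) (x : R3) :
    HasLineDerivAt ℝ (invBracket R) (-(x j) * invBracket R x ^ 3) x (basisVec j) := by
  have h1 : HasLineDerivAt ℝ (fun y : R3 ↦ R ^ 2 + (y 0 ^ 2 + y 1 ^ 2 + y 2 ^ 2)) (2 * x j) x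
      (basisVec j) := by
    have := ((((hasLineDerivAt_coord 0 j x).fun_pow 2).fun_add'
      ((hasLineDerivAt_coord 1 j x).fun_pow 2)).fun_add' ((hasLineDerivAt_coord 2 j x).fun_pow 2))
    have := HasDerivAt.const_add (R ^ 2) this
    unfold HasLineDerivAt
    convert! this using 1
    fin_cases j <;> simp
  have hpos : 0 < R ^ 2 + ‖x‖ ^ 2 := by positivity
  have h2 := HasDerivAt.inv (HasDerivAt.sqrt h1 (by
    simp only [zero_smul, add_zero, ← norm_sq_eq_coord]; exact hpos.ne'))
    (by simp only [zero_smul, add_zero, ← norm_sq_eq_coord]; positivity)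
  unfold HasLineDerivAt
  convert! h2 using 1
  · ext t
    simp [invBracket, norm_sq_eq_coord]
  · simp only [zero_smul, add_zero, ← norm_sq_eq_coord, invBracket]
    field_simp

/-! ### Schwartz functions and the divergence theorem -/

/-- The function underlying some real Schwartz map. -/
def IsSchwartz (F : R3 → ℝ) : Prop := ∃ G : 𝓢(R3, ℝ), ⇑G = F

theorem SchwartzMap.isSchwartz (u : 𝓢(R3, ℝ)) : IsSchwartz u := ⟨u, rfl⟩

namespace IsSchwartz

variable {F G c : R3 → ℝ}

theorem add (hF : IsSchwartz F) (hG : IsSchwartz G) : IsSchwartz (fun x ↦ F x + G x) := by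
  obtain ⟨f, rfl⟩ := hF
  obtain ⟨g, rfl⟩ := hG
  exact ⟨f + g, by ext; simp⟩

theorem sub (hF : IsSchwartz F) (hG : IsSchwartz G) : IsSchwartz (fun x ↦ F x - G x) := by
  obtain ⟨f, rfl⟩ := hF
  obtain ⟨g, rfl⟩ := hG
  exact ⟨f - g, by ext; simp⟩

theorem temperate_mul (hc : c.HasTemperateGrowth) (hF : IsSchwartz F) :
    IsSchwartz (fun x ↦ c x * F x) := by
  obtain ⟨f, rfl⟩ := hF
  exact ⟨SchwartzMap.smulLeftCLM ℝ c f, by ext x; simp [SchwartzMap.smulLeftCLM_apply_apply hc]⟩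

theorem hasTemperateGrowth (hF : IsSchwartz F) : F.HasTemperateGrowth := by
  obtain ⟨f, rfl⟩ := hF
  exact f.hasTemperateGrowth

theorem mul (hF : IsSchwartz F) (hG : IsSchwartz G) : IsSchwartz (fun x ↦ F x * G x) :=
  hG.temperate_mul hF.hasTemperateGrowth

theorem const_mul (a : ℝ) (hF : IsSchwartz F) : IsSchwartz (fun x ↦ a * F x) :=
  hF.temperate_mul (.const a)

theorem sq (hF : IsSchwartz F) : IsSchwartz (fun x ↦ F x ^ 2) := by
  simpa only [pow_two] using hF.mul hF

theorem integrable (hF : IsSchwartz F) : Integrable F := by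
  obtain ⟨f, rfl⟩ := hF
  exact f.integrable

theorem integral_lineDeriv_eq_zero (hF : IsSchwartz F) {d : R3 → ℝ} {v : R3}
    (hd : ∀ x, HasLineDerivAt ℝ F (d x) x v) : Integrable d ∧ ∫ x, d x = 0 := by
  obtain ⟨f, rfl⟩ := hF
  have hdf : d = ⇑(∂_{v} f : 𝓢(R3, ℝ)) := by
    ext x
    exact (hd x).unique (f.hasLineDerivAt x v)
  have hint : Integrable d := hdf ▸ (∂_{v} f : 𝓢(R3, ℝ)).integrable
  refine ⟨hint, ?_⟩
  -- Integration by parts against the constant function `1`.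
  have := integral_bilinear_hasLineDerivAt_right_eq_neg_left_of_integrable (μ := (volume : Measure R3))
    (B := ContinuousLinearMap.mul ℝ ℝ) (f := fun _ : R3 ↦ (1 : ℝ)) (f' := fun _ ↦ 0)
    (g := f) (g' := d) (v := v) (by simp) (by simpa using hint) (by simpa using f.integrable)
    (fun x _ ↦ by simpa [HasLineDerivAt] using hasDerivAt_const (0 : ℝ) (1 : ℝ))
    (fun x _ ↦ hd x)
  simpa using this

end IsSchwartz

theorem integral_divergence_eq_zero {F d : Fin 3 → R3 → ℝ} (hF : ∀ j, IsSchwartz (F j))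
    (hd : ∀ j x, HasLineDerivAt ℝ (F j) (d j x) x (basisVec j)) :
    ∫ x, (d 0 x + d 1 x + d 2 x) = 0 := by
  have h (j : Fin 3) := (hF j).integral_lineDeriv_eq_zero (hd j)
  have h01 := integral_add (h 0).1 (h 1).1
  have h2 := integral_add ((h 0).1.add (h 1).1) (h 2).1
  simp only [Pi.add_apply] at h2
  rw [h2, h01, (h 0).2, (h 1).2, (h 2).2]
  simp

theorem SchwartzMap.laplacian_apply_eq {F : Type*} [NormedAddCommGroup F] [NormedSpace ℝ F]
    (u : 𝓢(R3, F)) (x : R3) :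
    (Δ u) x = ∂_{basisVec 0} (∂_{basisVec 0} u) x + ∂_{basisVec 1} (∂_{basisVec 1} u) x
      + ∂_{basisVec 2} (∂_{basisVec 2} u) x := by
  rw [SchwartzMap.laplacian_eq_sum (EuclideanSpace.basisFun (Fin 3) ℝ), Fin.sum_univ_three]
  simp [basisVec]

theorem SchwartzMap.lineDerivOp_comm (u : 𝓢(R3, ℝ)) (v w x : R3) :
    ∂_{v} (∂_{w} u) x = ∂_{w} (∂_{v} u) x := by
  have key (v w : R3) : ∂_{v} (∂_{w} u) x = fderiv ℝ (fderiv ℝ u) x v w := by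
    rw [SchwartzMap.lineDerivOp_apply_eq_fderiv]
    have h1 : (⇑(∂_{w} u : 𝓢(R3, ℝ)) : R3 → ℝ) = fun y ↦ fderiv ℝ u y w := by
      ext y; rw [SchwartzMap.lineDerivOp_apply_eq_fderiv]
    have h2 : DifferentiableAt ℝ (fderiv ℝ u) x :=
      (SchwartzMap.fderivCLM ℝ R3 ℝ u).differentiableAt
    rw [h1, fderiv_clm_apply h2 (by fun_prop)]
    simp
  rw [key, key]
  exact ((u.contDiffAt 2).isSymmSndFDerivAt (by simp)).eq v w

/-! ### Multiplier identities for real functions -/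

section Virial

variable (u : 𝓢(R3, ℝ))

/-- The partial derivatives of a Schwartz function. -/
noncomputable abbrev SchwartzMap.pd {F : Type*} [NormedAddCommGroup F] [NormedSpace ℝ F]
    (u : 𝓢(R3, F)) (k : Fin 3) : 𝓢(R3, F) := ∂_{basisVec k} u

/-- The squared length of the gradient. -/
noncomputable def SchwartzMap.gradSq (x : R3) : ℝ := u.pd 0 x ^ 2 + u.pd 1 x ^ 2 + u.pd 2 x ^ 2

/-- The radial derivative `x · ∇u`. -/
noncomputable def SchwartzMap.euler (x : R3) : ℝ :=
  x 0 * u.pd 0 x + x 1 * u.pd 1 x + x 2 * u.pd 2 x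

theorem SchwartzMap.isSchwartz_gradSq : IsSchwartz u.gradSq :=
  (((u.pd 0).isSchwartz.sq).add (u.pd 1).isSchwartz.sq).add (u.pd 2).isSchwartz.sq

theorem SchwartzMap.isSchwartz_euler : IsSchwartz u.euler :=
  (((u.pd 0).isSchwartz.temperate_mul (hasTemperateGrowth_coord 0)).add
    ((u.pd 1).isSchwartz.temperate_mul (hasTemperateGrowth_coord 1))).add
    ((u.pd 2).isSchwartz.temperate_mul (hasTemperateGrowth_coord 2))

theorem SchwartzMap.euler_sq_le (x : R3) : u.euler x ^ 2 ≤ ‖x‖ ^ 2 * u.gradSq x := by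
  rw [norm_sq_eq_coord, SchwartzMap.euler, SchwartzMap.gradSq]
  nlinarith [sq_nonneg (x 0 * u.pd 1 x - x 1 * u.pd 0 x),
    sq_nonneg (x 0 * u.pd 2 x - x 2 * u.pd 0 x), sq_nonneg (x 1 * u.pd 2 x - x 2 * u.pd 1 x)]

theorem SchwartzMap.gradSq_nonneg (x : R3) : 0 ≤ u.gradSq x := by
  unfold SchwartzMap.gradSq; positivity

theorem SchwartzMap.hasLineDerivAt_gradSq (x : R3) (j : Fin 3) :
    HasLineDerivAt ℝ u.gradSq (2 * u.pd 0 x * (u.pd 0).pd j x + 2 * u.pd 1 x * (u.pd 1).pd j x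
      + 2 * u.pd 2 x * (u.pd 2).pd j x) x (basisVec j) := by
  have h (k : Fin 3) := ((u.pd k).hasLineDerivAt x (basisVec j)).fun_pow 2
  convert! ((h 0).fun_add' (h 1)).fun_add' (h 2) using 1
  simp

theorem SchwartzMap.hasLineDerivAt_euler (x : R3) (j : Fin 3) :
    HasLineDerivAt ℝ u.euler (u.pd j x + (x 0 * (u.pd 0).pd j x + x 1 * (u.pd 1).pd j x
      + x 2 * (u.pd 2).pd j x)) x (basisVec j) := by
  have h (k : Fin 3) := (hasLineDerivAt_coord k j x).fun_mul
    ((u.pd k).hasLineDerivAt x (basisVec j))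
  convert! ((h 0).fun_add' (h 1)).fun_add' (h 2) using 1
  fin_cases j <;> simp <;> ring

/-- The quadratic form produced by the radial multiplier. -/
noncomputable def virialForm (R : ℝ) (x : R3) : ℝ :=
  invBracket R x * u.gradSq x - invBracket R x ^ 3 * u.euler x ^ 2
    - 1 / 2 * R ^ 2 * invBracket R x ^ 3 * u.gradSq x
    + (1 / 2 * R ^ 2 * invBracket R x ^ 3 + 3 / 2 * R ^ 2 * invBracket R x ^ 5) * u x ^ 2

/-- By Cauchy–Schwarz `(x·∇u)² ≤ |x|² |∇u|²`, and `σ - σ³|x|² = R²σ³`, so the first two terms leave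
at least `R²σ³|∇u|²`, half of which absorbs the negative third term. -/
theorem le_virialForm {R : ℝ} (hR : 0 < R) (x : R3) :
    1 / 2 * (R ^ 2 * invBracket R x ^ 3 * (u x ^ 2 + u.gradSq x)) ≤ virialForm u R x := by
  have h0 := invBracket_pos hR x
  have h1 := invBracket_sq hR x
  have h2 := mul_le_mul_of_nonneg_left (u.euler_sq_le x) (pow_pos h0 3).le
  have h3 : invBracket R x * u.gradSq x - invBracket R x ^ 3 * (‖x‖ ^ 2 * u.gradSq x)
      = R ^ 2 * invBracket R x ^ 3 * u.gradSq x := by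
    linear_combination (-(invBracket R x * u.gradSq x)) * h1
  have h4 : 0 ≤ R ^ 2 * invBracket R x ^ 5 * u x ^ 2 := by positivity
  unfold virialForm
  nlinarith

theorem isSchwartz_virialForm {R : ℝ} (hR : 0 < R) : IsSchwartz (virialForm u R) := by
  have hs := hasTemperateGrowth_invBracket hR
  refine IsSchwartz.add (IsSchwartz.sub (IsSchwartz.sub ?_ ?_) ?_) ?_
  · exact u.isSchwartz_gradSq.temperate_mul hs
  · exact u.isSchwartz_euler.sq.temperate_mul (hs.pow 3)
  · exact u.isSchwartz_gradSq.temperate_mul ((Function.HasTemperateGrowth.const _).mul (hs.pow 3))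
  · exact u.isSchwartz.sq.temperate_mul (((Function.HasTemperateGrowth.const _).mul (hs.pow 3)).add
      ((Function.HasTemperateGrowth.const _).mul (hs.pow 5)))

theorem integral_virial {R : ℝ} (hR : 0 < R) :
    ∫ x, ((Δ u) x + u x) * ((u.euler x + u x) * invBracket R x) = - ∫ x, virialForm u R x := by
  have hs := hasTemperateGrowth_invBracket hR
  have hM : IsSchwartz (fun x ↦ invBracket R x * (u.euler x + u x)) :=
    (u.isSchwartz_euler.add u.isSchwartz).temperate_mul hs
  -- The field is `∂_j u · σ (x·∇u + u) + ½ x_j (σ (u² - |∇u|²) + σ³ u²)`. Its divergence is the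
  -- left integrand plus `virialForm`, modulo `σ² (R² + |x|²) = 1` and the symmetry of second
  -- derivatives.
  have hFs (j : Fin 3) := ((u.pd j).isSchwartz.mul hM).add
    ((((((u.isSchwartz.sq.sub u.isSchwartz_gradSq).temperate_mul hs).add
      (u.isSchwartz.sq.temperate_mul (hs.pow 3))).temperate_mul
      (hasTemperateGrowth_coord j))).const_mul (1 / 2))
  have hd (j : Fin 3) (x : R3) :=
    have hi := hasLineDerivAt_invBracket hR j x
    have hu := u.hasLineDerivAt x (basisVec j)
    (((u.pd j).hasLineDerivAt x (basisVec j)).fun_mul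
      (hi.fun_mul ((u.hasLineDerivAt_euler x j).fun_add' hu))).fun_add'
    (((hasLineDerivAt_coord j j x).fun_mul
      ((hi.fun_mul ((hu.fun_pow 2).fun_add' ((u.hasLineDerivAt_gradSq x j).fun_const_mul (-1)))).fun_add'
      ((hi.fun_pow 3).fun_mul (hu.fun_pow 2)))).fun_const_mul (1 / 2))
  have h := integral_divergence_eq_zero
    (fun j ↦ by simpa [← sub_eq_add_neg] using hFs j) hd
  have hl : IsSchwartz (fun x ↦ ((Δ u) x + u x) * ((u.euler x + u x) * invBracket R x)) := by
    simpa only [mul_comm] using ((Δ u).isSchwartz.add u.isSchwartz).mul hM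
  rw [eq_neg_iff_add_eq_zero, ← integral_add hl.integrable (isSchwartz_virialForm u hR).integrable]
  rw [← h]
  refine integral_congr_ae (.of_forall fun x ↦ ?_)
  have h1 := invBracket_sq hR x
  have e1 := u.lineDerivOp_comm (basisVec 0) (basisVec 1) x
  have e2 := u.lineDerivOp_comm (basisVec 0) (basisVec 2) x
  have e3 := u.lineDerivOp_comm (basisVec 1) (basisVec 2) x
  rw [norm_sq_eq_coord] at h1
  simp only [SchwartzMap.laplacian_apply_eq, virialForm, SchwartzMap.gradSq, SchwartzMap.euler,
    SchwartzMap.pd, e1, e2, e3]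
  simp only [if_true, Nat.cast_ofNat]
  generalize invBracket R x = σ at *
  linear_combination (-(1 / 2) * σ * (∂_{basisVec 0} u x ^ 2 + ∂_{basisVec 1} u x ^ 2
    + ∂_{basisVec 2} u x ^ 2) + (1 / 2 * σ + 3 / 2 * σ ^ 3) * u x ^ 2) * h1

/-- The divergence of `x σ_R σ_1³ u²` integrates to zero; `3σ_R - |x|²σ_R³ = 2σ_R + R²σ_R³` gives
the left side. -/
theorem integral_trace_identity {R : ℝ} (hR : 0 < R) :
    ∫ x, (2 * invBracket R x + R ^ 2 * invBracket R x ^ 3) * invBracket 1 x ^ 3 * u x ^ 2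
      = ∫ x, (3 * ‖x‖ ^ 2 * invBracket R x * invBracket 1 x ^ 5 * u x ^ 2
        - 2 * invBracket 1 x ^ 3 * invBracket R x * u x * u.euler x) := by
  have hs := hasTemperateGrowth_invBracket hR
  have hr := hasTemperateGrowth_invBracket one_pos
  have hF (j : Fin 3) := (((u.isSchwartz.sq.temperate_mul (hr.pow 3)).temperate_mul hs)).temperate_mul
    (hasTemperateGrowth_coord j)
  have hd (j : Fin 3) (x : R3) :=
    (hasLineDerivAt_coord j j x).fun_mul ((hasLineDerivAt_invBracket hR j x).fun_mul
      (((hasLineDerivAt_invBracket one_pos j x).fun_pow 3).fun_mul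
        ((u.hasLineDerivAt x (basisVec j)).fun_pow 2)))
  have h := integral_divergence_eq_zero hF hd
  have h1 : IsSchwartz fun x ↦
      (2 * invBracket R x + R ^ 2 * invBracket R x ^ 3) * invBracket 1 x ^ 3 * u x ^ 2 :=
    u.isSchwartz.sq.temperate_mul ((((Function.HasTemperateGrowth.const _).mul hs).add
      ((Function.HasTemperateGrowth.const _).mul (hs.pow 3))).mul (hr.pow 3))
  have h2 : IsSchwartz fun x ↦ (3 * ‖x‖ ^ 2 * invBracket R x * invBracket 1 x ^ 5 * u x ^ 2
        - 2 * invBracket 1 x ^ 3 * invBracket R x * u x * u.euler x) :=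
    (u.isSchwartz.sq.temperate_mul ((((Function.HasTemperateGrowth.const _).mul
      (Function.hasTemperateGrowth_norm_sq R3)).mul hs).mul (hr.pow 5))).sub
      (u.isSchwartz_euler.temperate_mul ((((Function.HasTemperateGrowth.const _).mul
        (hr.pow 3)).mul hs).mul u.hasTemperateGrowth))
  rw [← sub_eq_zero, ← integral_sub h1.integrable h2.integrable, ← h]
  refine integral_congr_ae (.of_forall fun x ↦ ?_)
  have h1 := invBracket_sq hR x
  rw [norm_sq_eq_coord] at h1
  simp only [SchwartzMap.euler, SchwartzMap.pd, norm_sq_eq_coord]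
  simp only [if_true, Nat.cast_ofNat]
  generalize invBracket R x = σ at *
  linear_combination σ * invBracket 1 x ^ 3 * u x ^ 2 * h1

/-- A Hardy-type inequality: `|x| σ_R ≤ 1` bounds the right side of the trace identity uniformly in
`R`. As `σ_R` has size `1/R` on the ball of radius `R`, it yields the factor `R` on small balls. -/
theorem integral_mul_sq_le_of_le_one {R : ℝ} (hR : 0 < R) :
    ∫ x, invBracket R x * invBracket 1 x ^ 3 * u x ^ 2
      ≤ 2 * ∫ x, invBracket 1 x ^ 3 * (u x ^ 2 + u.gradSq x) := by
  have hs := hasTemperateGrowth_invBracket hR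
  have hr := hasTemperateGrowth_invBracket one_pos
  have h1 : IsSchwartz fun x ↦
      (2 * invBracket R x + R ^ 2 * invBracket R x ^ 3) * invBracket 1 x ^ 3 * u x ^ 2 :=
    u.isSchwartz.sq.temperate_mul ((((Function.HasTemperateGrowth.const _).mul hs).add
      ((Function.HasTemperateGrowth.const _).mul (hs.pow 3))).mul (hr.pow 3))
  have h2 : IsSchwartz fun x ↦ (3 * ‖x‖ ^ 2 * invBracket R x * invBracket 1 x ^ 5 * u x ^ 2
        - 2 * invBracket 1 x ^ 3 * invBracket R x * u x * u.euler x) :=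
    (u.isSchwartz.sq.temperate_mul ((((Function.HasTemperateGrowth.const _).mul
      (Function.hasTemperateGrowth_norm_sq R3)).mul hs).mul (hr.pow 5))).sub
      (u.isSchwartz_euler.temperate_mul ((((Function.HasTemperateGrowth.const _).mul
        (hr.pow 3)).mul hs).mul u.hasTemperateGrowth))
  have h3 : IsSchwartz fun x ↦ invBracket R x * invBracket 1 x ^ 3 * u x ^ 2 :=
    u.isSchwartz.sq.temperate_mul (hs.mul (hr.pow 3))
  have h4 : IsSchwartz fun x ↦ invBracket 1 x ^ 3 * (u x ^ 2 + u.gradSq x) :=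
    (u.isSchwartz.sq.add u.isSchwartz_gradSq).temperate_mul (hr.pow 3)
  have e1 : 2 * ∫ x, invBracket R x * invBracket 1 x ^ 3 * u x ^ 2 ≤
      ∫ x, (2 * invBracket R x + R ^ 2 * invBracket R x ^ 3) * invBracket 1 x ^ 3 * u x ^ 2 := by
    rw [← integral_const_mul]
    refine integral_mono (h3.integrable.const_mul 2) h1.integrable fun x ↦ ?_
    have := invBracket_pos hR x
    have := invBracket_pos one_pos x
    have : 0 ≤ R ^ 2 * invBracket R x ^ 3 * invBracket 1 x ^ 3 * u x ^ 2 := by positivity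
    dsimp only
    linarith
  have e2 : ∫ x, (3 * ‖x‖ ^ 2 * invBracket R x * invBracket 1 x ^ 5 * u x ^ 2
        - 2 * invBracket 1 x ^ 3 * invBracket R x * u x * u.euler x)
      ≤ 4 * ∫ x, invBracket 1 x ^ 3 * (u x ^ 2 + u.gradSq x) := by
    rw [← integral_const_mul]
    refine integral_mono h2.integrable (h4.integrable.const_mul 4) fun x ↦ ?_
    have p0 := invBracket_pos hR x
    have p1 := invBracket_pos one_pos x
    have a1 := norm_mul_invBracket_le hR x
    have a2 := norm_mul_invBracket_le one_pos x
    have a3 := mul_invBracket_le one_pos x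
    rw [one_mul] at a3
    have a4 : ‖x‖ ^ 2 * invBracket R x * invBracket 1 x ^ 2 ≤ 1 := by
      calc ‖x‖ ^ 2 * invBracket R x * invBracket 1 x ^ 2
          = (‖x‖ * invBracket R x) * (‖x‖ * invBracket 1 x) * invBracket 1 x := by ring
        _ ≤ 1 * 1 * 1 := by gcongr
        _ = 1 := by norm_num
    have a5 : (invBracket R x * u.euler x) ^ 2 ≤ u.gradSq x := by
      calc (invBracket R x * u.euler x) ^ 2 = invBracket R x ^ 2 * u.euler x ^ 2 := by ring
        _ ≤ invBracket R x ^ 2 * (‖x‖ ^ 2 * u.gradSq x) := by gcongr; exact u.euler_sq_le x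
        _ = (‖x‖ * invBracket R x) ^ 2 * u.gradSq x := by ring
        _ ≤ 1 ^ 2 * u.gradSq x := by gcongr; exact u.gradSq_nonneg x
        _ = _ := by ring
    have a6 : -(2 * u x * (invBracket R x * u.euler x)) ≤ u x ^ 2 + u.gradSq x := by
      nlinarith [sq_nonneg (u x + invBracket R x * u.euler x)]
    have a7 := mul_le_mul_of_nonneg_left a4 (by positivity : 0 ≤ 3 * invBracket 1 x ^ 3 * u x ^ 2)
    have a8 := mul_le_mul_of_nonneg_left a6 (by positivity : 0 ≤ invBracket 1 x ^ 3)
    have a9 : 0 ≤ invBracket 1 x ^ 3 * u.gradSq x := mul_nonneg (by positivity) (u.gradSq_nonneg x)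
    dsimp only
    nlinarith
  linarith [integral_trace_identity u hR]

end Virial

/-! ### Dyadic rings and the `B`–`B*` duality -/

theorem measurableSet_dyadicRing (k : ℕ) : MeasurableSet (dyadicRing k) := by
  cases k with
  | zero => exact Metric.isOpen_ball.measurableSet
  | succ j =>
    exact (measurableSet_le measurable_const measurable_norm).inter
      (measurableSet_lt measurable_norm measurable_const)

theorem iUnion_dyadicRing : ⋃ k, dyadicRing k = Set.univ := by
  refine Set.eq_univ_of_forall fun x ↦ Set.mem_iUnion.2 ?_
  by_cases hx : ‖x‖ < 1
  · exact ⟨0, by simpa [dyadicRing] using hx⟩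
  · obtain ⟨n, hn⟩ := exists_nat_pow_near (not_lt.1 hx) one_lt_two
    exact ⟨n + 1, hn⟩

theorem norm_lt_of_mem_dyadicRing {k : ℕ} {x : R3} (hx : x ∈ dyadicRing k) : ‖x‖ < 2 ^ k := by
  cases k with
  | zero => simpa [dyadicRing] using hx
  | succ j => exact hx.2

theorem dyadicRing_subset_ball (k : ℕ) : dyadicRing k ⊆ Metric.ball 0 (2 ^ k) := fun x hx ↦ by
  simpa using norm_lt_of_mem_dyadicRing hx

theorem pairwise_disjoint_dyadicRing : Pairwise (Function.onFun Disjoint dyadicRing) := by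
  rw [(pairwise_disjoint_on dyadicRing)]
  intro m n hmn
  refine Set.disjoint_left.2 fun x hm hn ↦ ?_
  obtain ⟨j, rfl⟩ : ∃ j, n = j + 1 := ⟨n - 1, by omega⟩
  have h1 := norm_lt_of_mem_dyadicRing hm
  have h2 : (2 : ℝ) ^ j ≤ ‖x‖ := hn.1
  have h3 : (2 : ℝ) ^ m ≤ 2 ^ j := pow_le_pow_right₀ one_le_two (by omega)
  linarith

theorem lintegral_eq_tsum_dyadicRing (g : R3 → ℝ≥0∞) :
    ∫⁻ x, g x = ∑' k, ∫⁻ x in dyadicRing k, g x := by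
  rw [← setLIntegral_univ, ← iUnion_dyadicRing,
    lintegral_iUnion measurableSet_dyadicRing pairwise_disjoint_dyadicRing]

theorem ENNReal.tsum_sq_le_sq_tsum (c : ℕ → ℝ≥0∞) : ∑' k, c k ^ 2 ≤ (∑' k, c k) ^ 2 := by
  calc ∑' k, c k ^ 2 = ∑' k, c k * c k := by simp only [pow_two]
    _ ≤ ∑' k, c k * ∑' j, c j := by gcongr with k; exact ENNReal.le_tsum k
    _ = (∑' k, c k) ^ 2 := by rw [ENNReal.tsum_mul_right, pow_two]

theorem lintegral_enorm_sq_le_bNorm_sq (f : R3 → ℂ) : ∫⁻ x, ‖f x‖ₑ ^ 2 ≤ bNorm f ^ 2 := by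
  rw [lintegral_eq_tsum_dyadicRing]
  refine le_trans ?_ (ENNReal.tsum_sq_le_sq_tsum _)
  gcongr with k
  rw [← ENNReal.rpow_natCast, ← ENNReal.rpow_mul]
  norm_num
  exact le_mul_of_one_le_left' (one_le_pow₀ one_le_two)

/-- Cauchy–Schwarz on each ring; the weight `2^(k/2)` lost by `e` is the one carried by the `B`
norm. -/
theorem lintegral_mul_le_bNorm_mul {f : R3 → ℂ} (hf : AEMeasurable f) {e : R3 → ℝ≥0∞}
    (he : AEMeasurable e) {X : ℝ≥0∞}
    (hX : ∀ k, ∫⁻ x in dyadicRing k, e x ^ 2 ≤ 2 ^ k * X ^ 2) :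
    ∫⁻ x, ‖f x‖ₑ * e x ≤ bNorm f * X := by
  rw [lintegral_eq_tsum_dyadicRing, bNorm, ← ENNReal.tsum_mul_right]
  gcongr with k
  have h := ENNReal.lintegral_mul_le_Lp_mul_Lq (volume.restrict (dyadicRing k))
    (Real.HolderConjugate.two_two) hf.enorm.restrict he.restrict
  simp only [Pi.mul_apply, ENNReal.rpow_two] at h
  refine h.trans ?_
  calc _ ≤ (∫⁻ x in dyadicRing k, ‖f x‖ₑ ^ 2) ^ (1 / 2 : ℝ) * (2 ^ k * X ^ 2) ^ (1 / 2 : ℝ) := by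
        gcongr; exact hX k
    _ = _ := by
        rw [ENNReal.mul_rpow_of_nonneg _ _ (by norm_num), ENNReal.mul_rpow_of_nonneg _ _ (by norm_num),
          ← ENNReal.rpow_natCast X 2, ← ENNReal.rpow_mul]
        norm_num
        ring

/-! ### Complex functions and unweighted energy estimates -/

namespace SchwartzMap

variable (w : 𝓢(R3, ℂ))

/-- The real part of a complex Schwartz function. -/
noncomputable def rePart : 𝓢(R3, ℝ) := w.postcompCLM Complex.reCLM

/-- The imaginary part of a complex Schwartz function. -/
noncomputable def imPart : 𝓢(R3, ℝ) := w.postcompCLM Complex.imCLM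

@[simp] theorem rePart_apply (x : R3) : w.rePart x = (w x).re := by simp [rePart]

@[simp] theorem imPart_apply (x : R3) : w.imPart x = (w x).im := by simp [imPart]

theorem lineDerivOp_rePart (v : R3) : ∂_{v} w.rePart = (∂_{v} w).rePart := by
  ext x
  have h : (w.rePart : R3 → ℝ) = Complex.reCLM ∘ w := by ext; simp
  rw [rePart_apply, lineDerivOp_apply_eq_fderiv, lineDerivOp_apply_eq_fderiv, h,
    Complex.reCLM.hasFDerivAt.comp x (w.hasFDerivAt x) |>.fderiv]
  simp

theorem lineDerivOp_imPart (v : R3) : ∂_{v} w.imPart = (∂_{v} w).imPart := by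
  ext x
  have h : (w.imPart : R3 → ℝ) = Complex.imCLM ∘ w := by ext; simp
  rw [imPart_apply, lineDerivOp_apply_eq_fderiv, lineDerivOp_apply_eq_fderiv, h,
    Complex.imCLM.hasFDerivAt.comp x (w.hasFDerivAt x) |>.fderiv]
  simp

theorem laplacian_rePart (x : R3) : (Δ w.rePart) x = ((Δ w) x).re := by
  simp [laplacian_apply_eq, lineDerivOp_rePart]

theorem laplacian_imPart (x : R3) : (Δ w.imPart) x = ((Δ w) x).im := by
  simp [laplacian_apply_eq, lineDerivOp_imPart]

/-- The squared length of the gradient of a complex Schwartz function. -/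
noncomputable def cgradSq (x : R3) : ℝ := w.rePart.gradSq x + w.imPart.gradSq x

/-- The Helmholtz operator `Δ + z`. -/
noncomputable def helmholtz (z : ℂ) : 𝓢(R3, ℂ) := Δ w + z • w

theorem cgradSq_nonneg (x : R3) : 0 ≤ w.cgradSq x :=
  add_nonneg (gradSq_nonneg _ x) (gradSq_nonneg _ x)

theorem isSchwartz_cgradSq : IsSchwartz w.cgradSq :=
  w.rePart.isSchwartz_gradSq.add w.imPart.isSchwartz_gradSq

theorem isSchwartz_normSq : IsSchwartz (fun x ↦ ‖w x‖ ^ 2) := by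
  convert! w.rePart.isSchwartz.sq.add w.imPart.isSchwartz.sq using 2 with x
  rw [← Complex.normSq_eq_norm_sq, Complex.normSq_apply]
  simp [pow_two]

theorem integral_laplacian_mul_self (u : 𝓢(R3, ℝ)) : ∫ x, (Δ u) x * u x = - ∫ x, u.gradSq x := by
  have h (k : Fin 3) := integral_mul_lineDerivOp_right_eq_neg_left u (u.pd k) (basisVec k) (μ := volume)
  have hi (k : Fin 3) := ((u.isSchwartz.mul ((u.pd k).pd k).isSchwartz)).integrable
  have hj (k : Fin 3) := (((u.pd k).isSchwartz.mul (u.pd k).isSchwartz)).integrable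
  have e1 : ∫ x, (Δ u) x * u x = (∫ x, u x * (u.pd 0).pd 0 x) + (∫ x, u x * (u.pd 1).pd 1 x)
      + ∫ x, u x * (u.pd 2).pd 2 x := by
    rw [← integral_add (hi 0) (hi 1), ← integral_add (by exact (hi 0).add (hi 1)) (hi 2)]
    refine integral_congr_ae (.of_forall fun x ↦ ?_)
    simp only [laplacian_apply_eq, pd]
    ring
  have e2 : ∫ x, u.gradSq x = (∫ x, u.pd 0 x * u.pd 0 x) + (∫ x, u.pd 1 x * u.pd 1 x)
      + ∫ x, u.pd 2 x * u.pd 2 x := by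
    rw [← integral_add (hj 0) (hj 1), ← integral_add (by exact (hj 0).add (hj 1)) (hj 2)]
    refine integral_congr_ae (.of_forall fun x ↦ ?_)
    simp only [gradSq]
    ring
  simp only [pd] at h e1 e2 ⊢
  rw [e1, e2, h 0, h 1, h 2]
  ring

variable {w}

theorem integrable_norm_mul_sqrt (f : 𝓢(R3, ℂ)) {g : R3 → ℝ} (hg : IsSchwartz g) (h0 : ∀ x, 0 ≤ g x) :
    Integrable (fun x ↦ ‖f x‖ * √(g x)) := by
  refine Integrable.mono' (f.isSchwartz_normSq.integrable.add hg.integrable) ?_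
    (.of_forall fun x ↦ ?_)
  · have := hg.hasTemperateGrowth.1.continuous
    have := f.continuous
    exact Continuous.aestronglyMeasurable (by fun_prop)
  · rw [Real.norm_of_nonneg (by positivity), Pi.add_apply]
    have := Real.sq_sqrt (h0 x)
    nlinarith [sq_nonneg (‖f x‖ - √(g x)), norm_nonneg (f x), Real.sqrt_nonneg (g x)]

theorem integrable_norm_mul_norm (f w : 𝓢(R3, ℂ)) : Integrable (fun x ↦ ‖f x‖ * ‖w x‖) := by
  simpa [Real.sqrt_sq] using integrable_norm_mul_sqrt f w.isSchwartz_normSq (fun x ↦ by positivity)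

theorem helmholtz_re (a : ℝ) (x : R3) : ((w.helmholtz (1 - Complex.I * a)) x).re
    = (Δ w.rePart) x + w.rePart x + a * w.imPart x := by
  simp [helmholtz, laplacian_rePart, sub_mul]
  ring

theorem helmholtz_im (a : ℝ) (x : R3) : ((w.helmholtz (1 - Complex.I * a)) x).im
    = (Δ w.imPart) x + w.imPart x - a * w.rePart x := by
  simp [helmholtz, laplacian_imPart, sub_mul]
  ring

theorem _root_.abs_dot_le_norm_mul_sqrt (z : ℂ) (p q : ℝ) : |z.re * p + z.im * q| ≤ ‖z‖ * √(p ^ 2 + q ^ 2) := by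
  rw [← Real.sqrt_sq (norm_nonneg z), ← Real.sqrt_mul (by positivity), ← Complex.normSq_eq_norm_sq,
    Complex.normSq_apply]
  refine Real.abs_le_sqrt ?_
  nlinarith [sq_nonneg (z.re * q - z.im * p)]

theorem norm_eq_sqrt (w : 𝓢(R3, ℂ)) (x : R3) : ‖w x‖ = √(w.rePart x ^ 2 + w.imPart x ^ 2) := by
  rw [← Real.sqrt_sq (norm_nonneg (w x)), ← Complex.normSq_eq_norm_sq, Complex.normSq_apply]
  simp [pow_two]

/-- Imaginary part of the equation paired with the conjugate of `w`: the Laplacian is symmetric and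
drops out. -/
theorem absorption_bound (w : 𝓢(R3, ℂ)) (a : ℝ) :
    a * ∫ x, ‖w x‖ ^ 2 ≤ ∫ x, ‖w.helmholtz (1 - Complex.I * a) x‖ * ‖w x‖ := by
  have e := integral_mul_laplacian_right_eq_left w.rePart w.imPart (μ := volume)
  have i1 := (w.rePart.isSchwartz.mul (Δ w.imPart).isSchwartz).integrable
  have i2 := ((Δ w.rePart).isSchwartz.mul w.imPart.isSchwartz).integrable
  rw [← sub_eq_zero, ← integral_sub i1 i2] at e
  have i3 := w.isSchwartz_normSq.integrable
  rw [← integral_const_mul, ← sub_zero (∫ x, a * _), ← e, ← integral_sub (i3.const_mul a) (by exact i1.sub i2)]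
  refine integral_mono ((i3.const_mul a).sub (i1.sub i2)) (integrable_norm_mul_norm _ _) fun x ↦ ?_
  have h := abs_dot_le_norm_mul_sqrt (w.helmholtz (1 - Complex.I * a) x) (-w.imPart x) (w.rePart x)
  rw [neg_sq, add_comm (w.imPart x ^ 2), ← norm_eq_sqrt] at h
  refine le_trans ?_ ((neg_le_abs _).trans h)
  rw [helmholtz_re, helmholtz_im, norm_eq_sqrt, Real.sq_sqrt (by positivity)]
  dsimp only
  linarith

/-- Real part of the same pairing: here the absorption drops out. -/
theorem gradient_bound (w : 𝓢(R3, ℂ)) (a : ℝ) :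
    ∫ x, w.cgradSq x ≤
      (∫ x, ‖w x‖ ^ 2) + ∫ x, ‖w.helmholtz (1 - Complex.I * a) x‖ * ‖w x‖ := by
  have e1 := integral_laplacian_mul_self w.rePart
  have e2 := integral_laplacian_mul_self w.imPart
  have i1 := ((Δ w.rePart).isSchwartz.mul w.rePart.isSchwartz).integrable
  have i2 := ((Δ w.imPart).isSchwartz.mul w.imPart.isSchwartz).integrable
  have i3 := w.isSchwartz_normSq.integrable
  have i4 := w.rePart.isSchwartz_gradSq.integrable
  have i5 := w.imPart.isSchwartz_gradSq.integrable
  have e3 : ∫ x, w.cgradSq x = - ∫ x, ((Δ w.rePart) x * w.rePart x + (Δ w.imPart) x * w.imPart x) := by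
    rw [integral_add i1 i2, e1, e2, ← neg_add, neg_neg, ← integral_add i4 i5]
    rfl
  rw [e3, ← integral_neg, ← integral_add i3 (integrable_norm_mul_norm _ _)]
  refine integral_mono (i1.add i2).neg (i3.add (integrable_norm_mul_norm _ _)) fun x ↦ ?_
  have h := abs_dot_le_norm_mul_sqrt (w.helmholtz (1 - Complex.I * a) x) (w.rePart x) (w.imPart x)
  rw [← norm_eq_sqrt] at h
  have h' := (neg_le_abs _).trans h
  rw [helmholtz_re, helmholtz_im] at h'
  have : ‖w x‖ ^ 2 = w.rePart x ^ 2 + w.imPart x ^ 2 := by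
    rw [norm_eq_sqrt, Real.sq_sqrt (by positivity)]
  dsimp only
  nlinarith

/-- The absorption bound combined with `2a|f||w| ≤ |f|² + a²|w|²`. It handles large absorption and
makes approximate solutions Cauchy in `L²`. -/
theorem lagrangian_bound (w : 𝓢(R3, ℂ)) {a : ℝ} (ha : 0 < a) :
    a ^ 2 * ∫ x, ‖w x‖ ^ 2 ≤ ∫ x, ‖w.helmholtz (1 - Complex.I * a) x‖ ^ 2 := by
  set f := w.helmholtz (1 - Complex.I * a)
  have h := absorption_bound w a
  have i3 := w.isSchwartz_normSq.integrable
  have i4 := f.isSchwartz_normSq.integrable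
  have h2 : 2 * a * ∫ x, ‖f x‖ * ‖w x‖ ≤ (∫ x, ‖f x‖ ^ 2) + a ^ 2 * ∫ x, ‖w x‖ ^ 2 := by
    rw [← integral_const_mul, ← integral_const_mul, ← integral_add i4 (i3.const_mul _)]
    refine integral_mono ((integrable_norm_mul_norm _ _).const_mul _) (i4.add (i3.const_mul _))
      fun x ↦ ?_
    dsimp only
    nlinarith [sq_nonneg (‖f x‖ - a * ‖w x‖)]
  nlinarith

end SchwartzMap

/-! ### Weighted energy and the uniform estimate -/

namespace SchwartzMap

variable (w : 𝓢(R3, ℂ))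

/-- The energy density `|w|² + |∇w|²`. -/
noncomputable def energy (x : R3) : ℝ := ‖w x‖ ^ 2 + w.cgradSq x

theorem isSchwartz_energy : IsSchwartz w.energy := w.isSchwartz_normSq.add w.isSchwartz_cgradSq

theorem energy_nonneg (x : R3) : 0 ≤ w.energy x := add_nonneg (by positivity) (w.cgradSq_nonneg x)

theorem normSq_le_energy (x : R3) : ‖w x‖ ^ 2 ≤ w.energy x :=
  le_add_of_nonneg_right (w.cgradSq_nonneg x)

theorem norm_le_sqrt_energy (x : R3) : ‖w x‖ ≤ √(w.energy x) :=
  Real.le_sqrt_of_sq_le (w.normSq_le_energy x)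

theorem flux_bound {a : ℝ} (ha : 0 < a) :
    a * ∫ x, ‖w x‖ * √(w.cgradSq x) ≤
      3 / 2 * (∫ x, ‖w.helmholtz (1 - Complex.I * a) x‖ * ‖w x‖)
        + 1 / 2 * ∫ x, ‖w.helmholtz (1 - Complex.I * a) x‖ ^ 2 := by
  have h1 := absorption_bound w a
  have h2 := gradient_bound w a
  have h3 := lagrangian_bound w ha
  have iw := w.isSchwartz_normSq.integrable
  have ig := w.isSchwartz_cgradSq.integrable
  have i0 := integrable_norm_mul_sqrt w w.isSchwartz_cgradSq w.cgradSq_nonneg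
  have key (s : ℝ) (hs : 0 < s) : 2 * s * ∫ x, ‖w x‖ * √(w.cgradSq x) ≤
      s ^ 2 * (∫ x, ‖w x‖ ^ 2) + ∫ x, w.cgradSq x := by
    rw [← integral_const_mul, ← integral_const_mul, ← integral_add (iw.const_mul _) ig]
    refine integral_mono (i0.const_mul _) ((iw.const_mul _).add ig) fun x ↦ ?_
    have := Real.sq_sqrt (w.cgradSq_nonneg x)
    dsimp only
    nlinarith [sq_nonneg (s * ‖w x‖ - √(w.cgradSq x))]
  have hF : 0 ≤ ∫ x, ‖w.helmholtz (1 - Complex.I * a) x‖ ^ 2 := by positivity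
  have hK : 0 ≤ ∫ x, ‖w.helmholtz (1 - Complex.I * a) x‖ * ‖w x‖ := by positivity
  have hW : 0 ≤ ∫ x, ‖w x‖ ^ 2 := by positivity
  -- Young's inequality is balanced differently in the two regimes: with `s = 1` the factor `a` is
  -- spent on `∫ |w|²`, while with `s = a` the term `a² ∫ |w|²` costs `∫ |f|²`.
  rcases le_or_gt a 1 with h | h
  · have := mul_le_mul_of_nonneg_left (key 1 one_pos) ha.le
    nlinarith
  · have := key a ha
    nlinarith

theorem weighted_energy_bound {a R : ℝ} (ha : 0 < a) (hR : 1 ≤ R) :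
    ∫ x, R ^ 2 * invBracket R x ^ 3 * w.energy x ≤
      7 * (∫ x, ‖w.helmholtz (1 - Complex.I * a) x‖ * √(w.energy x))
        + ∫ x, ‖w.helmholtz (1 - Complex.I * a) x‖ ^ 2 := by
  have hR0 : 0 < R := by linarith
  set f := w.helmholtz (1 - Complex.I * a) with hf
  have hfl := flux_bound w ha
  rw [← hf] at hfl
  have hK : ∫ x, ‖f x‖ * ‖w x‖ ≤ ∫ x, ‖f x‖ * √(w.energy x) :=
    integral_mono (integrable_norm_mul_norm _ _)
      (integrable_norm_mul_sqrt f w.isSchwartz_energy w.energy_nonneg) fun x ↦ by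
        dsimp only
        gcongr
        exact w.norm_le_sqrt_energy x
  have hs := hasTemperateGrowth_invBracket hR0
  have v1 := integral_virial w.rePart hR0
  have v2 := integral_virial w.imPart hR0
  have hM (u : 𝓢(R3, ℝ)) :
      Integrable fun x ↦ ((Δ u) x + u x) * ((u.euler x + u x) * invBracket R x) := by
    have := ((Δ u).isSchwartz.add u.isSchwartz).mul
      ((u.isSchwartz_euler.add u.isSchwartz).temperate_mul hs)
    simpa only [mul_comm] using this.integrable
  have iv (u : 𝓢(R3, ℝ)) := (isSchwartz_virialForm u hR0).integrable
  have iJ : Integrable fun x ↦ R ^ 2 * invBracket R x ^ 3 * w.energy x :=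
    (w.isSchwartz_energy.temperate_mul ((Function.HasTemperateGrowth.const _).mul (hs.pow 3))).integrable
  have ife := integrable_norm_mul_sqrt f w.isSchwartz_energy w.energy_nonneg
  have iwg := integrable_norm_mul_sqrt w w.isSchwartz_cgradSq w.cgradSq_nonneg
  have e1 : 1 / 2 * ∫ x, R ^ 2 * invBracket R x ^ 3 * w.energy x ≤
      (∫ x, virialForm w.rePart R x) + ∫ x, virialForm w.imPart R x := by
    rw [← integral_const_mul, ← integral_add (iv _) (iv _)]
    refine integral_mono (iJ.const_mul _) ((iv _).add (iv _)) fun x ↦ ?_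
    have k1 := le_virialForm w.rePart hR0 x
    have k2 := le_virialForm w.imPart hR0 x
    dsimp only [energy, cgradSq]
    rw [norm_eq_sqrt, Real.sq_sqrt (by positivity)]
    linarith
  have e2 : (∫ x, virialForm w.rePart R x) + ∫ x, virialForm w.imPart R x ≤
      2 * (∫ x, ‖f x‖ * √(w.energy x)) + a * ∫ x, ‖w x‖ * √(w.cgradSq x) := by
    rw [← neg_neg (∫ x, virialForm w.rePart R x), ← neg_neg (∫ x, virialForm w.imPart R x), ← v1, ← v2,
      ← neg_add, ← integral_add (hM _) (hM _), ← integral_neg, ← integral_const_mul,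
      ← integral_const_mul, ← integral_add (ife.const_mul _) (iwg.const_mul _)]
    refine integral_mono ((hM _).add (hM _)).neg ((ife.const_mul _).add (iwg.const_mul _)) fun x ↦ ?_
    set σ := invBracket R x
    have σ0 : 0 < σ := invBracket_pos hR0 x
    -- `R ≥ 1` enters here, to bound the zeroth-order part `σ w` of the multiplier.
    have σ1 : σ ≤ 1 := by nlinarith [mul_invBracket_le hR0 x]
    have g1 : √((σ * w.rePart.euler x) ^ 2 + (σ * w.imPart.euler x) ^ 2) ≤ √(w.cgradSq x) := by
      apply Real.sqrt_le_sqrt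
      calc (σ * w.rePart.euler x) ^ 2 + (σ * w.imPart.euler x) ^ 2
          = σ ^ 2 * (w.rePart.euler x ^ 2 + w.imPart.euler x ^ 2) := by ring
        _ ≤ σ ^ 2 * (‖x‖ ^ 2 * w.rePart.gradSq x + ‖x‖ ^ 2 * w.imPart.gradSq x) := by
            gcongr <;> exact euler_sq_le _ x
        _ = (‖x‖ * σ) ^ 2 * w.cgradSq x := by rw [cgradSq]; ring
        _ ≤ 1 ^ 2 * w.cgradSq x := by
            gcongr
            · exact w.cgradSq_nonneg x
            · exact norm_mul_invBracket_le hR0 x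
        _ = w.cgradSq x := by ring
    have g2 : √(w.cgradSq x) ≤ √(w.energy x) :=
      Real.sqrt_le_sqrt (le_add_of_nonneg_left (by positivity))
    have a1 := abs_dot_le_norm_mul_sqrt (f x) (σ * w.rePart.euler x) (σ * w.imPart.euler x)
    have a2 := abs_dot_le_norm_mul_sqrt (f x) (w.rePart x) (w.imPart x)
    -- The absorption contributes `a σ (Im w · x·∇Re w - Re w · x·∇Im w)`; its zeroth-order parts
    -- cancel between the real and imaginary equations.
    have a3 := abs_dot_le_norm_mul_sqrt (w x) (-(σ * w.imPart.euler x)) (σ * w.rePart.euler x)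
    rw [neg_sq, add_comm ((σ * w.imPart.euler x) ^ 2)] at a3
    rw [← norm_eq_sqrt] at a2
    have b1 := (neg_le_abs _).trans (a1.trans (mul_le_mul_of_nonneg_left (g1.trans g2) (norm_nonneg _)))
    have b2 := (neg_le_abs _).trans (a2.trans (mul_le_mul_of_nonneg_left (w.norm_le_sqrt_energy x)
      (norm_nonneg _)))
    have b3 := mul_le_mul_of_nonneg_left ((le_abs_self _).trans
      (a3.trans (mul_le_mul_of_nonneg_left g1 (norm_nonneg _)))) ha.le
    have c : 0 ≤ ‖f x‖ * √(w.energy x) := by positivity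
    have b4 := mul_le_mul_of_nonneg_left b2 σ0.le
    have b5 : σ * (‖f x‖ * √(w.energy x)) ≤ ‖f x‖ * √(w.energy x) := by nlinarith
    rw [hf, helmholtz_re, helmholtz_im, ← hf] at b1 b4
    rw [← rePart_apply, ← imPart_apply] at b3
    dsimp only
    linarith
  linarith

theorem setIntegral_energy_le {R : ℝ} (hR : 0 < R) :
    ∫ x in Metric.ball 0 R, w.energy x ≤ 3 * R * ∫ x, R ^ 2 * invBracket R x ^ 3 * w.energy x := by
  have hs := hasTemperateGrowth_invBracket hR
  have iJ : Integrable fun x ↦ R ^ 2 * invBracket R x ^ 3 * w.energy x :=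
    (w.isSchwartz_energy.temperate_mul ((Function.HasTemperateGrowth.const _).mul (hs.pow 3))).integrable
  rw [← integral_const_mul]
  refine le_trans ?_ (setIntegral_le_integral (s := Metric.ball 0 R) (iJ.const_mul _)
    (.of_forall fun x ↦ ?_))
  · refine setIntegral_mono_on w.isSchwartz_energy.integrable.integrableOn
      (iJ.const_mul _).integrableOn measurableSet_ball fun x hx ↦ ?_
    have h1 := le_mul_invBracket hR (x := x) (by simpa using (mem_ball_zero_iff.1 hx).le)
    have h0 : 0 < R * invBracket R x := mul_pos hR (invBracket_pos hR x)
    -- On the ball `Rσ ≥ 1/√2`, and `2√2 ≤ 3`.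
    have h2 : 1 ≤ 3 * (R * invBracket R x) ^ 3 := by
      set t := R * invBracket R x
      have : 2 / 3 ≤ t := by nlinarith
      nlinarith
    calc w.energy x = 1 * w.energy x := by ring
      _ ≤ 3 * (R * invBracket R x) ^ 3 * w.energy x := by
        gcongr
        exact w.energy_nonneg x
      _ = _ := by ring
  · have := w.energy_nonneg x
    have := invBracket_pos hR x
    simp only [Pi.zero_apply]
    positivity

theorem setIntegral_normSq_le_of_le_one {R : ℝ} (hR : 0 < R) (hR1 : R ≤ 1) :
    ∫ x in Metric.ball 0 R, ‖w x‖ ^ 2 ≤ 8 * R * ∫ x, invBracket 1 x ^ 3 * w.energy x := by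
  have hs := hasTemperateGrowth_invBracket hR
  have hr := hasTemperateGrowth_invBracket one_pos
  have i1 (u : 𝓢(R3, ℝ)) : Integrable fun x ↦ invBracket R x * invBracket 1 x ^ 3 * u x ^ 2 :=
    (u.isSchwartz.sq.temperate_mul (hs.mul (hr.pow 3))).integrable
  have i2 (u : 𝓢(R3, ℝ)) : Integrable fun x ↦ invBracket 1 x ^ 3 * (u x ^ 2 + u.gradSq x) :=
    ((u.isSchwartz.sq.add u.isSchwartz_gradSq).temperate_mul (hr.pow 3)).integrable
  have i3 : Integrable fun x ↦ invBracket R x * invBracket 1 x ^ 3 * ‖w x‖ ^ 2 :=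
    (w.isSchwartz_normSq.temperate_mul (hs.mul (hr.pow 3))).integrable
  have h1 := integral_mul_sq_le_of_le_one w.rePart hR
  have h2 := integral_mul_sq_le_of_le_one w.imPart hR
  have h3 : ∫ x, invBracket R x * invBracket 1 x ^ 3 * ‖w x‖ ^ 2 ≤
      2 * ∫ x, invBracket 1 x ^ 3 * w.energy x := by
    calc ∫ x, invBracket R x * invBracket 1 x ^ 3 * ‖w x‖ ^ 2
        = (∫ x, invBracket R x * invBracket 1 x ^ 3 * w.rePart x ^ 2)
          + ∫ x, invBracket R x * invBracket 1 x ^ 3 * w.imPart x ^ 2 := by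
          rw [← integral_add (i1 _) (i1 _)]
          refine integral_congr_ae (.of_forall fun x ↦ ?_)
          dsimp only
          rw [norm_eq_sqrt, Real.sq_sqrt (by positivity)]
          ring
      _ ≤ _ := add_le_add h1 h2
      _ = 2 * ∫ x, invBracket 1 x ^ 3 * w.energy x := by
          rw [← mul_add, ← integral_add (i2 _) (i2 _)]
          congr 1
          refine integral_congr_ae (.of_forall fun x ↦ ?_)
          dsimp only [energy, cgradSq]
          rw [norm_eq_sqrt, Real.sq_sqrt (by positivity)]
          ring
  suffices h4 : ∫ x in Metric.ball 0 R, ‖w x‖ ^ 2 ≤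
      4 * R * ∫ x, invBracket R x * invBracket 1 x ^ 3 * ‖w x‖ ^ 2 by
    nlinarith
  rw [← integral_const_mul]
  refine le_trans ?_ (setIntegral_le_integral (s := Metric.ball 0 R) (i3.const_mul _)
    (.of_forall fun x ↦ ?_))
  · refine setIntegral_mono_on w.isSchwartz_normSq.integrable.integrableOn
      (i3.const_mul _).integrableOn measurableSet_ball fun x hx ↦ ?_
    have hx' : ‖x‖ ≤ R := by simpa using (mem_ball_zero_iff.1 hx).le
    have k1 := le_mul_invBracket hR hx'
    have k2 := le_mul_invBracket one_pos (hx'.trans hR1)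
    have h0 : 0 < R * invBracket R x := mul_pos hR (invBracket_pos hR x)
    have h1 := invBracket_pos one_pos x
    rw [one_mul] at k2
    -- Both `R σ_R` and `σ_1` are at least `1/√2` here, since `|x| ≤ R ≤ 1`.
    have : 1 ≤ 4 * (R * invBracket R x) * invBracket 1 x ^ 3 := by
      set t := R * invBracket R x
      set s := invBracket 1 x
      have q1 : 1 / 4 ≤ (t * s) ^ 2 := by nlinarith
      have q2 : 1 / 2 ≤ t * s := by nlinarith [mul_pos h0 h1]
      nlinarith
    calc ‖w x‖ ^ 2 = 1 * ‖w x‖ ^ 2 := by ring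
      _ ≤ 4 * (R * invBracket R x) * invBracket 1 x ^ 3 * ‖w x‖ ^ 2 := by gcongr
      _ = _ := by ring
  · have := invBracket_pos one_pos x
    have := invBracket_pos hR x
    simp only [Pi.zero_apply]
    positivity

theorem integral_norm_mul_sqrt_energy_le (f : 𝓢(R3, ℂ)) {b X : ℝ} (hb : 0 ≤ b) (hX : 0 ≤ X)
    (hfb : bNorm f ≤ ENNReal.ofReal b)
    (h : ∀ k : ℕ, ∫ x in Metric.ball 0 (2 ^ k), w.energy x ≤ 2 ^ k * X ^ 2) :
    ∫ x, ‖f x‖ * √(w.energy x) ≤ b * X := by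
  have hc : Continuous w.energy := w.isSchwartz_energy.hasTemperateGrowth.1.continuous
  have ife := integrable_norm_mul_sqrt f w.isSchwartz_energy w.energy_nonneg
  have key := lintegral_mul_le_bNorm_mul (f := f) f.continuous.measurable.aemeasurable
    (e := fun x ↦ ENNReal.ofReal √(w.energy x)) (by fun_prop) (X := ENNReal.ofReal X) (fun k ↦ by
      calc ∫⁻ x in dyadicRing k, ENNReal.ofReal √(w.energy x) ^ 2
          ≤ ∫⁻ x in Metric.ball 0 (2 ^ k), ENNReal.ofReal √(w.energy x) ^ 2 :=
            lintegral_mono_set (dyadicRing_subset_ball k)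
        _ = ∫⁻ x in Metric.ball 0 (2 ^ k), ENNReal.ofReal (w.energy x) := by
            refine lintegral_congr fun x ↦ ?_
            rw [← ENNReal.ofReal_pow (Real.sqrt_nonneg _), Real.sq_sqrt (w.energy_nonneg x)]
        _ = ENNReal.ofReal (∫ x in Metric.ball 0 (2 ^ k), w.energy x) := by
            rw [ofReal_integral_eq_lintegral_ofReal w.isSchwartz_energy.integrable.integrableOn
              (.of_forall w.energy_nonneg)]
        _ ≤ ENNReal.ofReal (2 ^ k * X ^ 2) := ENNReal.ofReal_le_ofReal (h k)
        _ = 2 ^ k * ENNReal.ofReal X ^ 2 := by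
            rw [ENNReal.ofReal_mul (by positivity), ENNReal.ofReal_pow (by norm_num),
              ENNReal.ofReal_pow hX]
            norm_num)
  rw [← ENNReal.ofReal_le_ofReal_iff (by positivity), ofReal_integral_eq_lintegral_ofReal ife
    (.of_forall fun x ↦ by positivity), ENNReal.ofReal_mul hb]
  refine le_trans (le_of_eq ?_) (key.trans (mul_le_mul_left hfb _))
  refine lintegral_congr fun x ↦ ?_
  rw [ENNReal.ofReal_mul (norm_nonneg _), ofReal_norm]

theorem integral_normSq_le_of_bNorm_le (f : 𝓢(R3, ℂ)) {b : ℝ} (hb : 0 ≤ b)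
    (hfb : bNorm f ≤ ENNReal.ofReal b) : ∫ x, ‖f x‖ ^ 2 ≤ b ^ 2 := by
  rw [← ENNReal.ofReal_le_ofReal_iff (by positivity), ofReal_integral_eq_lintegral_ofReal
    f.isSchwartz_normSq.integrable (.of_forall fun x ↦ by positivity), ENNReal.ofReal_pow hb]
  refine le_trans (le_of_eq ?_) ((lintegral_enorm_sq_le_bNorm_sq f).trans (pow_le_pow_left' hfb 2))
  refine lintegral_congr fun x ↦ ?_
  rw [ENNReal.ofReal_pow (norm_nonneg _), ofReal_norm]

/-- Uniform limiting absorption estimate for Schwartz functions. -/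
theorem setIntegral_normSq_le_of_bNorm_le {a b R : ℝ} (ha : 0 < a) (hb : 0 ≤ b)
    (hfb : bNorm (w.helmholtz (1 - Complex.I * a)) ≤ ENNReal.ofReal b) (hR : 0 < R) :
    ∫ x in Metric.ball 0 R, ‖w x‖ ^ 2 ≤ 1240 * R * b ^ 2 := by
  set f := w.helmholtz (1 - Complex.I * a) with hf
  have hF := integral_normSq_le_of_bNorm_le f hb hfb
  have hE := w.isSchwartz_energy.integrable
  have hball (r : ℝ) : ∫ x in Metric.ball 0 r, w.energy x ≤ ∫ x, w.energy x :=
    setIntegral_le_integral hE (.of_forall w.energy_nonneg)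
  have hball0 (r : ℝ) : 0 ≤ ∫ x in Metric.ball 0 r, w.energy x :=
    setIntegral_nonneg measurableSet_ball fun x _ ↦ w.energy_nonneg x
  set Y : ℕ → ℝ := fun k ↦ (2 ^ k)⁻¹ * ∫ x in Metric.ball 0 (2 ^ k), w.energy x with hY
  -- The supremum is finite a priori because `w` is Schwartz, so `X` can later be absorbed.
  have hYb : BddAbove (Set.range Y) := by
    refine ⟨∫ x, w.energy x, ?_⟩
    rintro _ ⟨k, rfl⟩
    have : ((2 : ℝ) ^ k)⁻¹ ≤ 1 := inv_le_one_of_one_le₀ (one_le_pow₀ one_le_two)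
    calc Y k ≤ 1 * ∫ x in Metric.ball 0 (2 ^ k), w.energy x := by
          simp only [hY]; gcongr; exact hball0 _
      _ ≤ _ := by rw [one_mul]; exact hball _
  have hS0 : 0 ≤ ⨆ k, Y k := Real.iSup_nonneg fun k ↦ mul_nonneg (by positivity) (hball0 _)
  set X := √(⨆ k, Y k) with hX
  have hX2 : X ^ 2 = ⨆ k, Y k := Real.sq_sqrt hS0
  have hX0 : 0 ≤ X := Real.sqrt_nonneg _
  have hP := integral_norm_mul_sqrt_energy_le w f hb hX0 hfb fun k ↦ by
    have := le_ciSup hYb k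
    rw [← hX2, hY, inv_mul_le_iff₀ (by positivity)] at this
    exact this
  have hJ (r : ℝ) (hr : 1 ≤ r) : ∫ x, r ^ 2 * invBracket r x ^ 3 * w.energy x ≤ 7 * (b * X) + b ^ 2 := by
    have := weighted_energy_bound w ha hr
    rw [← hf] at this
    linarith
  have hXle : X ^ 2 ≤ 3 * (7 * (b * X) + b ^ 2) := by
    rw [hX2]
    refine ciSup_le fun k ↦ ?_
    have h1 := setIntegral_energy_le w (R := 2 ^ k) (by positivity)
    have h2 := hJ (2 ^ k) (one_le_pow₀ one_le_two)
    rw [hY, inv_mul_le_iff₀ (by positivity)]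
    have : (0 : ℝ) < 2 ^ k := by positivity
    nlinarith
  -- `X² ≤ 21bX + 3b²` fails as soon as `X > 22b`. Below, `155 = 7·22 + 1`, and `1240 = 8·155`
  -- exceeds the `3·155` needed for large radii.
  have hX22 : X ≤ 22 * b := by
    by_contra! hlt
    nlinarith
  have hJ' (r : ℝ) (hr : 1 ≤ r) : ∫ x, r ^ 2 * invBracket r x ^ 3 * w.energy x ≤ 155 * b ^ 2 := by
    have := hJ r hr
    nlinarith
  rcases le_or_gt R 1 with h | h
  · have h1 := setIntegral_normSq_le_of_le_one w hR h
    have h2 := hJ' 1 le_rfl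
    simp only [one_pow, one_mul] at h2
    nlinarith
  · have h1 := setIntegral_energy_le w hR
    have h2 := hJ' R h.le
    have h3 : ∫ x in Metric.ball 0 R, ‖w x‖ ^ 2 ≤ ∫ x in Metric.ball 0 R, w.energy x :=
      setIntegral_mono w.isSchwartz_normSq.integrable.integrableOn hE.integrableOn
        w.normSq_le_energy
    nlinarith [sq_nonneg b]

end SchwartzMap

/-! ### Inverting the Helmholtz operator and the weak formulation -/

/-- With `t = 4π²|ξ|²`, the inverse is the conjugate of `z - t` times `(Im z)⁻² (1 + s²)⁻¹`, where
`s = (Re z - t) / Im z`; each factor is visibly tempered. -/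
theorem hasTemperateGrowth_inv_helmholtz_symbol {z : ℂ} (hz : z.im ≠ 0) :
    (fun ξ : R3 ↦ (z - (((2 * Real.pi) ^ 2 * ‖ξ‖ ^ 2 : ℝ) : ℂ))⁻¹).HasTemperateGrowth := by
  set t : R3 → ℝ := fun ξ ↦ (2 * Real.pi) ^ 2 * ‖ξ‖ ^ 2 with ht
  have htg : t.HasTemperateGrowth :=
    (Function.HasTemperateGrowth.const _).mul (Function.hasTemperateGrowth_norm_sq R3)
  have hh : (fun ξ ↦ (1 + ‖(z.re - t ξ) * z.im⁻¹‖ ^ 2) ^ (-1 : ℝ)).HasTemperateGrowth :=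
    (Function.hasTemperateGrowth_one_add_norm_sq_rpow ℝ (-1)).comp
      (((Function.HasTemperateGrowth.const z.re).sub htg).mul (.const z.im⁻¹))
  have hcomb : (fun ξ ↦ ((starRingEnd ℂ) z - ((t ξ : ℝ) : ℂ)) *
      (((z.im ^ 2)⁻¹ * (1 + ‖(z.re - t ξ) * z.im⁻¹‖ ^ 2) ^ (-1 : ℝ) : ℝ) : ℂ)).HasTemperateGrowth :=
    ((Function.HasTemperateGrowth.const _).sub (Function.Complex.hasTemperateGrowth_ofReal.comp htg)).mul
      (Function.Complex.hasTemperateGrowth_ofReal.comp ((Function.HasTemperateGrowth.const _).mul hh))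
  convert! hcomb using 2 with ξ
  have h1 : z - ((t ξ : ℝ) : ℂ) ≠ 0 := fun h ↦ hz (by simpa using congrArg Complex.im h)
  have h2 : (z.im ^ 2)⁻¹ * (1 + ‖(z.re - t ξ) * z.im⁻¹‖ ^ 2) ^ (-1 : ℝ)
      = ((z.re - t ξ) ^ 2 + z.im ^ 2)⁻¹ := by
    rw [Real.rpow_neg_one, Real.norm_eq_abs, sq_abs, ← mul_inv]
    congr 1
    field_simp
    ring
  rw [h2, Complex.inv_def]
  congr 1
  · rw [map_sub, Complex.conj_ofReal]
  · rw [Complex.normSq_apply]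
    simp [pow_two, ht]

namespace SchwartzMap

theorem helmholtz_eq_fourierMultiplierCLM (z : ℂ) (w : 𝓢(R3, ℂ)) : w.helmholtz z =
    fourierMultiplierCLM ℂ (fun ξ : R3 ↦ z - (((2 * Real.pi) ^ 2 * ‖ξ‖ ^ 2 : ℝ) : ℂ)) w := by
  have hq := Function.hasTemperateGrowth_norm_sq R3
  have hp : (fun ξ : R3 ↦ z - (((2 * Real.pi) ^ 2 * ‖ξ‖ ^ 2 : ℝ) : ℂ)).HasTemperateGrowth :=
    (Function.HasTemperateGrowth.const _).sub (Function.Complex.hasTemperateGrowth_ofReal.comp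
      ((Function.HasTemperateGrowth.const _).mul hq))
  rw [helmholtz, laplacian_eq_fourierMultiplierCLM]
  conv_lhs => rw [← FourierTransform.fourierInv_fourier_eq (F := 𝓢(R3, ℂ)) w]
  rw [fourierMultiplierCLM_apply, fourierMultiplierCLM_apply,
    FourierTransform.fourier_fourierInv_eq, ← FourierTransform.fourierInv_smul,
    ← FourierTransform.fourierInv_smul, ← FourierTransform.fourierInv_add]
  congr 1
  ext ξ
  have hq' : (fun x : R3 ↦ ‖x‖ ^ 2).HasTemperateGrowth := hq
  rw [smulLeftCLM_apply_apply hp]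
  simp [smulLeftCLM_apply_apply hq']
  ring

theorem exists_helmholtz_eq {z : ℂ} (hz : z.im ≠ 0) (f : 𝓢(R3, ℂ)) :
    ∃ w : 𝓢(R3, ℂ), w.helmholtz z = f := by
  have hm := hasTemperateGrowth_inv_helmholtz_symbol hz
  have hp : (fun ξ : R3 ↦ z - (((2 * Real.pi) ^ 2 * ‖ξ‖ ^ 2 : ℝ) : ℂ)).HasTemperateGrowth :=
    (Function.HasTemperateGrowth.const _).sub (Function.Complex.hasTemperateGrowth_ofReal.comp
      ((Function.HasTemperateGrowth.const _).mul (Function.hasTemperateGrowth_norm_sq R3)))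
  refine ⟨fourierMultiplierCLM ℂ
    (fun ξ : R3 ↦ (z - (((2 * Real.pi) ^ 2 * ‖ξ‖ ^ 2 : ℝ) : ℂ))⁻¹) f, ?_⟩
  rw [helmholtz_eq_fourierMultiplierCLM, fourierMultiplierCLM_fourierMultiplierCLM_apply hp hm]
  have : ((fun ξ : R3 ↦ z - (((2 * Real.pi) ^ 2 * ‖ξ‖ ^ 2 : ℝ) : ℂ)) *
      fun ξ : R3 ↦ (z - (((2 * Real.pi) ^ 2 * ‖ξ‖ ^ 2 : ℝ) : ℂ))⁻¹) = fun _ ↦ 1 := by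
    ext ξ
    exact mul_inv_cancel₀ fun h ↦ hz (by
      have := congrArg Complex.im h
      rw [Complex.sub_im, Complex.ofReal_im] at this
      simpa using this)
  rw [this, fourierMultiplierCLM_const]
  simp

theorem integral_helmholtz_mul (z : ℂ) (φ w : 𝓢(R3, ℂ)) :
    ∫ x, φ.helmholtz z x * w x = ∫ x, φ x * w.helmholtz z x := by
  have h := integral_mul_laplacian_right_eq_left φ w (μ := volume)
  have i (f g : 𝓢(R3, ℂ)) : Integrable fun x ↦ f x * g x := by
    refine Integrable.mono' (integrable_norm_mul_norm f g) ?_ (.of_forall fun x ↦ by simp)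
    exact (f.continuous.mul g.continuous).aestronglyMeasurable
  have e1 : ∫ x, φ.helmholtz z x * w x = (∫ x, (Δ φ) x * w x) + ∫ x, z * (φ x * w x) := by
    rw [← integral_add (i _ _) ((i _ _).const_mul z)]
    refine integral_congr_ae (.of_forall fun x ↦ ?_)
    simp [helmholtz]
    ring
  have e2 : ∫ x, φ x * w.helmholtz z x = (∫ x, φ x * (Δ w) x) + ∫ x, z * (φ x * w x) := by
    rw [← integral_add (i _ _) ((i _ _).const_mul z)]
    refine integral_congr_ae (.of_forall fun x ↦ ?_)
    simp [helmholtz]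
    ring
  rw [e1, e2, h]

end SchwartzMap

/-- Every Schwartz function is of the form `φ.helmholtz z`, so `u` and `v` agree as tempered
distributions, and `L²` embeds in those. -/
theorem Lp_ext_of_integral_helmholtz_eq {z : ℂ} (hz : z.im ≠ 0) {u v : Lp ℂ 2 (volume : Measure R3)}
    (h : ∀ φ : 𝓢(R3, ℂ), ∫ x, φ.helmholtz z x * u x = ∫ x, φ.helmholtz z x * v x) : u = v := by
  have hk := LinearMap.ker_eq_bot.1 (Lp.ker_toTemperedDistributionCLM_eq_bot (E := R3) (F := ℂ)
    (μ := volume) (p := 2))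
  apply hk
  ext g
  obtain ⟨φ, rfl⟩ := SchwartzMap.exists_helmholtz_eq hz g
  simpa using h φ

theorem continuous_integral_mul_Lp (ψ : 𝓢(R3, ℂ)) :
    Continuous fun u : Lp ℂ 2 (volume : Measure R3) ↦ ∫ x, ψ x * u x := by
  have h := (PointwiseConvergenceCLM.evalCLM (RingHom.id ℂ) (E := 𝓢(R3, ℂ)) ℂ ψ).continuous.comp
    (Lp.toTemperedDistributionCLM (E := R3) ℂ volume 2).continuous
  convert! h using 2 with u
  exact (Lp.toTemperedDistribution_apply u ψ).symm

theorem isHelmholtzSolution_iff {ε a : ℝ} {S : R3 → ℂ} {u : Lp ℂ 2 (volume : Measure R3)} :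
    IsHelmholtzSolution ε a S u ↔ ∀ φ : 𝓢(R3, ℂ),
      ∫ x, φ.helmholtz (((1 / ε ^ 2 : ℝ) : ℂ) - Complex.I * ((a / ε : ℝ) : ℂ)) x * u x
        = ∫ x, φ x * S x := by
  refine forall_congr' fun φ ↦ ?_
  rw [← Lp.toTemperedDistributionCLM_apply]
  have : (-(Complex.I * ((a / ε : ℝ) : ℂ)) • (Lp.toTemperedDistributionCLM ℂ volume 2 u : 𝓢'(R3, ℂ))
    + Δ (Lp.toTemperedDistributionCLM ℂ volume 2 u : 𝓢'(R3, ℂ))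
      + ((1 / ε ^ 2 : ℝ) : ℂ) • (Lp.toTemperedDistributionCLM ℂ volume 2 u : 𝓢'(R3, ℂ))) φ =
      (Lp.toTemperedDistributionCLM ℂ volume 2 u : 𝓢'(R3, ℂ))
        (φ.helmholtz (((1 / ε ^ 2 : ℝ) : ℂ) - Complex.I * ((a / ε : ℝ) : ℂ))) := by
    rw [SchwartzMap.helmholtz, map_add, map_smul]
    simp
    ring
  rw [this]
  simp

/-! ### Density of Schwartz functions in `B` -/

theorem eLpNorm_two_eq {f : R3 → ℂ} {μ : Measure R3} :
    eLpNorm f 2 μ = (∫⁻ x, ‖f x‖ₑ ^ 2 ∂μ) ^ (1 / 2 : ℝ) := by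
  rw [eLpNorm_eq_lintegral_rpow_enorm_toReal (by norm_num) (by norm_num)]
  norm_num

theorem bNorm_eq_tsum_eLpNorm (f : R3 → ℂ) :
    bNorm f = ∑' k : ℕ, (2 ^ k : ℝ≥0∞) ^ (1 / 2 : ℝ) * eLpNorm f 2 (volume.restrict (dyadicRing k)) := by
  refine tsum_congr fun k ↦ ?_
  rw [ENNReal.mul_rpow_of_nonneg _ _ (by norm_num), eLpNorm_two_eq]

theorem eLpNorm_two_le_bNorm (f : R3 → ℂ) : eLpNorm f 2 volume ≤ bNorm f := by
  rw [eLpNorm_two_eq]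
  calc _ ≤ (bNorm f ^ 2) ^ (1 / 2 : ℝ) := by gcongr; exact lintegral_enorm_sq_le_bNorm_sq f
    _ = bNorm f := by
      rw [← ENNReal.rpow_natCast, ← ENNReal.rpow_mul]
      norm_num

theorem MemB.memLp {f : R3 → ℂ} (hf : MemB f) : MemLp f 2 volume :=
  ⟨hf.aestronglyMeasurable, (eLpNorm_two_le_bNorm f).trans_lt hf.bNorm_lt_top⟩

/-- Schwartz functions are dense in `B ∩ L²` with control of the `B` norm. -/
theorem MemB.exists_schwartz_approx {f : R3 → ℂ} (hf : MemB f) {δ : ℝ} (hδ : 0 < δ) :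
    ∃ g : 𝓢(R3, ℂ), bNorm g ≤ bNorm f + ENNReal.ofReal δ ∧
      eLpNorm (f - ⇑g) 2 volume ≤ ENNReal.ofReal δ := by
  -- Two approximations are needed. The first only fixes a radius `2^N` beyond which `f` is small in
  -- `L²`; the second, `h`, is cut off at that scale and its accuracy may depend on `N`.
  obtain ⟨g₁, hg₁c, hg₁, hfg₁⟩ :=
    hf.memLp.exist_eLpNorm_sub_le (by norm_num) (by norm_num) (half_pos hδ)
  obtain ⟨N, hN⟩ : ∃ N : ℕ, ∀ x, (2 : ℝ) ^ N ≤ ‖x‖ → g₁ x = 0 := by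
    obtain ⟨r, hr⟩ := hg₁c.isCompact.isBounded.subset_closedBall 0
    obtain ⟨N, hN⟩ := pow_unbounded_of_one_lt r one_lt_two
    refine ⟨N, fun x hx ↦ image_eq_zero_of_notMem_tsupport fun hx' ↦ ?_⟩
    have := mem_closedBall_zero_iff.1 (hr hx')
    linarith
  -- The cutoff lives in the rings of index at most `N + 1`, and `M` bounds the total `B` weight `∑
  -- 2^(k/2)` there, so an `L²` error `η` costs at most `M η = δ / 2`.
  set M : ℝ := ∑ k ∈ Finset.range (N + 2), 2 ^ k with hM
  have hM1 : 1 ≤ M := by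
    calc (1 : ℝ) = 2 ^ 0 := by norm_num
      _ ≤ M := Finset.single_le_sum (f := fun k ↦ (2 : ℝ) ^ k) (fun _ _ ↦ by positivity) (by simp)
  set η : ℝ := δ / 2 / M with hη
  have hη0 : 0 < η := by positivity
  obtain ⟨h, hhc, hh, hfh⟩ := hf.memLp.exist_eLpNorm_sub_le (by norm_num) (by norm_num) hη0
  let χ : ContDiffBump (0 : R3) := ⟨2 ^ N, 2 ^ (N + 1), by positivity, by gcongr <;> norm_num⟩
  have hχ1 (x : R3) (hx : ‖x‖ ≤ 2 ^ N) : χ x = 1 :=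
    χ.one_of_mem_closedBall (by simpa [χ] using hx)
  have hχ0 (x : R3) (hx : 2 ^ (N + 1) ≤ ‖x‖) : χ x = 0 :=
    χ.zero_of_le_dist (by simpa [χ] using hx)
  have hgc : HasCompactSupport fun x ↦ ((χ x : ℝ) : ℂ) * h x := hhc.mul_left
  have hgs : ContDiff ℝ ((⊤ : ℕ∞) : WithTop ℕ∞) fun x ↦ ((χ x : ℝ) : ℂ) * h x :=
    (Complex.ofRealCLM.contDiff.comp χ.contDiff).mul hh
  refine ⟨hgc.toSchwartzMap hgs, ?_, ?_⟩
  · have hcoe : ⇑(hgc.toSchwartzMap hgs) = fun x ↦ ((χ x : ℝ) : ℂ) * h x := rfl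
    have hring (k : ℕ) : eLpNorm (fun x ↦ ((χ x : ℝ) : ℂ) * h x) 2 (volume.restrict (dyadicRing k)) ≤
        eLpNorm f 2 (volume.restrict (dyadicRing k)) + ENNReal.ofReal η := by
      calc _ ≤ eLpNorm h 2 (volume.restrict (dyadicRing k)) := by
            refine eLpNorm_mono_ae (.of_forall fun x ↦ ?_)
            rw [norm_mul, Complex.norm_real, Real.norm_of_nonneg χ.nonneg]
            exact mul_le_of_le_one_left (norm_nonneg _) χ.le_one
        _ = eLpNorm (f - (f - h)) 2 (volume.restrict (dyadicRing k)) := by simp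
        _ ≤ eLpNorm f 2 (volume.restrict (dyadicRing k))
            + eLpNorm (f - h) 2 (volume.restrict (dyadicRing k)) :=
            eLpNorm_sub_le hf.aestronglyMeasurable.restrict
              (hf.aestronglyMeasurable.sub hh.continuous.aestronglyMeasurable).restrict (by norm_num)
        _ ≤ _ := by
            gcongr
            exact (eLpNorm_mono_measure _ Measure.restrict_le_self).trans hfh
    have hzero (k : ℕ) (hk : k ∉ Finset.range (N + 2)) :
        eLpNorm (fun x ↦ ((χ x : ℝ) : ℂ) * h x) 2 (volume.restrict (dyadicRing k)) = 0 := by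
      refine (eLpNorm_congr_ae (g := 0) ?_).trans eLpNorm_zero
      filter_upwards [ae_restrict_mem (measurableSet_dyadicRing k)] with x hx
      obtain ⟨j, rfl⟩ : ∃ j, k = j + 1 := ⟨k - 1, by simp at hk; omega⟩
      have hj : N + 1 ≤ j := by simp at hk; omega
      have : (2 : ℝ) ^ (N + 1) ≤ ‖x‖ := (pow_le_pow_right₀ one_le_two hj).trans hx.1
      simp [hχ0 x this]
    rw [hcoe, bNorm_eq_tsum_eLpNorm, bNorm_eq_tsum_eLpNorm]
    rw [tsum_eq_sum (s := Finset.range (N + 2)) fun k hk ↦ by rw [hzero k hk, mul_zero]]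
    calc _ ≤ ∑ k ∈ Finset.range (N + 2), ((2 ^ k : ℝ≥0∞) ^ (1 / 2 : ℝ)
          * eLpNorm f 2 (volume.restrict (dyadicRing k)) + 2 ^ k * ENNReal.ofReal η) := by
          refine Finset.sum_le_sum fun k _ ↦ ?_
          refine (mul_le_mul_right (hring k) _).trans ?_
          rw [mul_add]
          gcongr
          calc (2 ^ k : ℝ≥0∞) ^ (1 / 2 : ℝ) ≤ (2 ^ k : ℝ≥0∞) ^ (1 : ℝ) :=
                ENNReal.rpow_le_rpow_of_exponent_le (one_le_pow₀ one_le_two) (by norm_num)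
            _ = 2 ^ k := ENNReal.rpow_one _
      _ ≤ _ := by
          rw [Finset.sum_add_distrib]
          gcongr
          · exact ENNReal.sum_le_tsum _
          · rw [← Finset.sum_mul]
            have : (∑ k ∈ Finset.range (N + 2), (2 : ℝ≥0∞) ^ k) = ENNReal.ofReal M := by
              rw [hM, ENNReal.ofReal_sum_of_nonneg fun _ _ ↦ by positivity]
              refine Finset.sum_congr rfl fun k _ ↦ ?_
              rw [ENNReal.ofReal_pow (by norm_num)]
              norm_num
            rw [this, ← ENNReal.ofReal_mul (by positivity)]
            apply ENNReal.ofReal_le_ofReal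
            rw [hη]
            field_simp
            linarith
  · have hcoe : ⇑(hgc.toSchwartzMap hgs) = fun x ↦ ((χ x : ℝ) : ℂ) * h x := rfl
    have hsplit : f - ⇑(hgc.toSchwartzMap hgs) = (fun x ↦ ((χ x : ℝ) : ℂ) * (f x - h x)) +
        fun x ↦ (1 - ((χ x : ℝ) : ℂ)) * f x := by
      ext x
      simp [hcoe]
      ring
    have hχc : Continuous fun x ↦ ((χ x : ℝ) : ℂ) := Complex.continuous_ofReal.comp χ.continuous
    rw [hsplit]
    refine (eLpNorm_add_le (hχc.aestronglyMeasurable.mul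
      (hf.aestronglyMeasurable.sub hh.continuous.aestronglyMeasurable))
      ((continuous_const.sub hχc).aestronglyMeasurable.mul hf.aestronglyMeasurable)
      (by norm_num)).trans ?_
    have e1 : eLpNorm (fun x ↦ ((χ x : ℝ) : ℂ) * (f x - h x)) 2 volume ≤ ENNReal.ofReal (δ / 2) := by
      refine (eLpNorm_mono_ae (g := f - h) (.of_forall fun x ↦ ?_)).trans (hfh.trans ?_)
      · rw [norm_mul, Complex.norm_real, Real.norm_of_nonneg χ.nonneg]
        exact mul_le_of_le_one_left (norm_nonneg _) χ.le_one
      · exact ENNReal.ofReal_le_ofReal (div_le_self (by positivity) hM1)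
    have e2 : eLpNorm (fun x ↦ (1 - ((χ x : ℝ) : ℂ)) * f x) 2 volume ≤ ENNReal.ofReal (δ / 2) := by
      refine (eLpNorm_mono_ae (g := f - g₁) (.of_forall fun x ↦ ?_)).trans hfg₁
      rcases le_total ‖x‖ (2 ^ N) with hx | hx
      · simp [hχ1 x hx]
      · rw [Pi.sub_apply, hN x hx, sub_zero, ← Complex.ofReal_one, ← Complex.ofReal_sub, norm_mul,
          Complex.norm_real, Real.norm_of_nonneg (sub_nonneg.2 χ.le_one)]
        exact mul_le_of_le_one_left (norm_nonneg _) (sub_le_self _ χ.nonneg)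
    refine (add_le_add e1 e2).trans ?_
    rw [← ENNReal.ofReal_add (by positivity) (by positivity), add_halves]

/-! ### Passing to the limit at unit wave number -/

namespace SchwartzMap

theorem eLpNorm_restrict_ball_le (w : 𝓢(R3, ℂ)) {a R : ℝ} (ha : 0 < a) (hR : 0 < R) {b : ℝ≥0∞}
    (hb : b ≠ ⊤) (h : bNorm (w.helmholtz (1 - Complex.I * a)) ≤ b) :
    eLpNorm w 2 (volume.restrict (Metric.ball 0 R)) ≤ ENNReal.ofReal √(1240 * R) * b := by
  have key := w.setIntegral_normSq_le_of_bNorm_le ha (b := b.toReal) ENNReal.toReal_nonneg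
    (by rwa [ENNReal.ofReal_toReal hb]) hR
  rw [eLpNorm_two_eq]
  have e : ∫⁻ x in Metric.ball 0 R, ‖w x‖ₑ ^ 2 = ENNReal.ofReal (∫ x in Metric.ball 0 R, ‖w x‖ ^ 2) := by
    rw [ofReal_integral_eq_lintegral_ofReal w.isSchwartz_normSq.integrable.integrableOn
      (.of_forall fun x ↦ by positivity)]
    refine lintegral_congr fun x ↦ ?_
    rw [ENNReal.ofReal_pow (norm_nonneg _), ofReal_norm]
  rw [e]
  calc _ ≤ (ENNReal.ofReal ((√(1240 * R) * b.toReal) ^ 2)) ^ (1 / 2 : ℝ) := by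
        gcongr
        rw [mul_pow, Real.sq_sqrt (by positivity)]
        exact key
    _ = ENNReal.ofReal √(1240 * R) * b := by
        rw [ENNReal.ofReal_pow (by positivity), ← ENNReal.rpow_natCast, ← ENNReal.rpow_mul,
          ENNReal.ofReal_mul (by positivity), ENNReal.ofReal_toReal hb]
        norm_num

theorem norm_toLp_sq (w : 𝓢(R3, ℂ)) : ‖w.toLp 2 volume‖ ^ 2 = ∫ x, ‖w x‖ ^ 2 := by
  rw [norm_toLp' (by norm_num) (by norm_num)]
  norm_num
  rw [← Real.sqrt_eq_rpow, Real.sq_sqrt (by positivity)]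

theorem norm_toLp_le_helmholtz (w : 𝓢(R3, ℂ)) {a : ℝ} (ha : 0 < a) :
    a * ‖w.toLp 2 volume‖ ≤ ‖(w.helmholtz (1 - Complex.I * a)).toLp 2 volume‖ := by
  have := lagrangian_bound w ha
  rw [← norm_toLp_sq, ← norm_toLp_sq, ← mul_pow] at this
  exact (sq_le_sq₀ (by positivity) (by positivity)).1 this

theorem helmholtz_sub (z : ℂ) (v w : 𝓢(R3, ℂ)) :
    (v - w).helmholtz z = v.helmholtz z - w.helmholtz z := by
  have : Δ (v - w) = Δ v - Δ w := by
    rw [← laplacianCLM_eq', map_sub]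
    rfl
  rw [helmholtz, this, helmholtz, helmholtz, smul_sub]
  abel

end SchwartzMap

/-- Existence of the solution at unit wave number, with the uniform estimate on all balls. -/
theorem MemB.exists_solution {f : R3 → ℂ} (hf : MemB f) {a : ℝ} (ha : 0 < a) :
    ∃ u : Lp ℂ 2 (volume : Measure R3),
      (∀ φ : 𝓢(R3, ℂ), ∫ x, φ.helmholtz (1 - Complex.I * a) x * u x = ∫ x, φ x * f x) ∧
      ∀ R : ℝ, 0 < R →
        eLpNorm u 2 (volume.restrict (Metric.ball 0 R)) ≤ ENNReal.ofReal √(1240 * R) * bNorm f := by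
  have him : (1 - Complex.I * (a : ℂ)).im ≠ 0 := by simp [ha.ne']
  choose g hgb hgf using fun n : ℕ ↦ hf.exists_schwartz_approx (δ := 1 / ((n : ℝ) + 1)) (by positivity)
  choose w hw using fun n ↦ SchwartzMap.exists_helmholtz_eq him (g n)
  set F := hf.memLp.toLp f with hF
  have hδ : Tendsto (fun n : ℕ ↦ ENNReal.ofReal (1 / ((n : ℝ) + 1))) atTop (𝓝 0) := by
    simpa using ENNReal.tendsto_ofReal tendsto_one_div_add_atTop_nhds_zero_nat
  have hgF : Tendsto (fun n ↦ (g n).toLp 2 volume) atTop (𝓝 F) := by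
    rw [tendsto_iff_edist_tendsto_0]
    refine tendsto_of_tendsto_of_tendsto_of_le_of_le tendsto_const_nhds hδ (fun _ ↦ zero_le) fun n ↦ ?_
    rw [edist_comm, Lp.edist_def]
    refine le_trans (le_of_eq (eLpNorm_congr_ae ?_)) (hgf n)
    exact hf.memLp.coeFn_toLp.sub ((g n).coeFn_toLp 2 volume)
  -- The `L²` resolvent bound `1/a` depends on `a`, but it serves only for convergence; the uniform
  -- constant comes from the ball estimate.
  have hwc : CauchySeq fun n ↦ (w n).toLp 2 volume := by
    have hc := hgF.cauchySeq
    rw [Metric.cauchySeq_iff] at hc ⊢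
    intro ε hε
    obtain ⟨N, hN⟩ := hc (a * ε) (by positivity)
    refine ⟨N, fun m hm n hn ↦ ?_⟩
    have h1 := hN m hm n hn
    have h2 := SchwartzMap.norm_toLp_le_helmholtz (w m - w n) ha
    rw [SchwartzMap.helmholtz_sub, hw, hw] at h2
    simp only [← SchwartzMap.toLpCLM_apply (𝕜 := ℝ), map_sub] at h2
    rw [dist_eq_norm] at h1 ⊢
    simp only [SchwartzMap.toLpCLM_apply] at h2
    exact lt_of_mul_lt_mul_left (h2.trans_lt h1) ha.le
  obtain ⟨u, hu⟩ := cauchySeq_tendsto_of_complete hwc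
  refine ⟨u, fun φ ↦ ?_, fun R hR ↦ ?_⟩
  · have h1 := ((continuous_integral_mul_Lp (φ.helmholtz (1 - Complex.I * a))).tendsto u).comp hu
    have h2 := ((continuous_integral_mul_Lp φ).tendsto F).comp hgF
    have h3 : ∫ x, φ x * F x = ∫ x, φ x * f x := by
      refine integral_congr_ae ?_
      filter_upwards [hf.memLp.coeFn_toLp] with x hx
      rw [hF, hx]
    rw [← h3]
    refine tendsto_nhds_unique h1 (h2.congr fun n ↦ ?_)
    have e1 : ∫ x, φ.helmholtz (1 - Complex.I * a) x * ((w n).toLp 2 volume : R3 → ℂ) x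
        = ∫ x, φ.helmholtz (1 - Complex.I * a) x * w n x := by
      refine integral_congr_ae ?_
      filter_upwards [(w n).coeFn_toLp 2 volume] with x hx
      rw [hx]
    have e2 : ∫ x, φ x * ((g n).toLp 2 volume : R3 → ℂ) x = ∫ x, φ x * g n x := by
      refine integral_congr_ae ?_
      filter_upwards [(g n).coeFn_toLp 2 volume] with x hx
      rw [hx]
    simp only [Function.comp_apply]
    rw [e1, e2, SchwartzMap.integral_helmholtz_mul, hw]
  · have hlim : Tendsto (fun n : ℕ ↦ edist u ((w n).toLp 2 volume) + ENNReal.ofReal √(1240 * R) *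
        (bNorm f + ENNReal.ofReal (1 / ((n : ℝ) + 1)))) atTop
        (𝓝 (0 + ENNReal.ofReal √(1240 * R) * (bNorm f + 0))) := by
      refine Tendsto.add ?_ (ENNReal.Tendsto.const_mul (tendsto_const_nhds.add hδ)
        (.inr ENNReal.ofReal_ne_top))
      simpa only [edist_comm] using tendsto_iff_edist_tendsto_0.1 hu
    rw [zero_add, add_zero] at hlim
    refine ge_of_tendsto' hlim fun n ↦ ?_
    have hb := (w n).eLpNorm_restrict_ball_le ha hR (b := bNorm f + ENNReal.ofReal (1 / ((n : ℝ) + 1)))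
      (by simp [hf.bNorm_lt_top.ne]) (by rw [hw]; exact hgb n)
    have hwn := (w n).coeFn_toLp 2 volume
    calc eLpNorm u 2 (volume.restrict (Metric.ball 0 R))
        = eLpNorm (((u : R3 → ℂ) - ((w n).toLp 2 volume : R3 → ℂ)) + ((w n).toLp 2 volume : R3 → ℂ)) 2
          (volume.restrict (Metric.ball 0 R)) := by simp
      _ ≤ eLpNorm ((u : R3 → ℂ) - ((w n).toLp 2 volume : R3 → ℂ)) 2 (volume.restrict (Metric.ball 0 R))
          + eLpNorm ((w n).toLp 2 volume : R3 → ℂ) 2 (volume.restrict (Metric.ball 0 R)) :=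
          eLpNorm_add_le ((Lp.aestronglyMeasurable _).sub (Lp.aestronglyMeasurable _)).restrict
            (Lp.aestronglyMeasurable _).restrict (by norm_num)
      _ ≤ _ := by
          refine add_le_add ?_ ?_
          · rw [Lp.edist_def]
            exact eLpNorm_mono_measure _ Measure.restrict_le_self
          · rw [eLpNorm_congr_ae (ae_restrict_of_ae hwn)]
            exact hb

/-! ### Rescaling to wave number `1/ε` -/

/-- Rescaling about the point `q`. -/
noncomputable def rescale (ε : ℝ) (q x : R3) : R3 := ε⁻¹ • (x - q)

theorem measurable_rescale (ε : ℝ) (q : R3) : Measurable (rescale ε q) := by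
  unfold rescale; fun_prop

theorem map_rescale {ε : ℝ} (hε : 0 < ε) (q : R3) :
    Measure.map (rescale ε q) volume = ENNReal.ofReal (ε ^ 3) • (volume : Measure R3) := by
  have h : rescale ε q = (fun x ↦ ε⁻¹ • x) ∘ fun x ↦ x - q := rfl
  rw [h, ← Measure.map_map (by fun_prop) (by fun_prop), map_sub_right_eq_self,
    Measure.map_addHaar_smul _ (inv_ne_zero hε.ne')]
  congr 2
  simp [abs_of_pos hε]

theorem integral_comp_rescale {ε : ℝ} (hε : 0 < ε) (q : R3) (g : R3 → ℂ) :
    ∫ x, g (rescale ε q x) = ((ε ^ 3 : ℝ) : ℂ) * ∫ y, g y := by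
  have h1 := integral_sub_right_eq_self (μ := (volume : Measure R3)) (fun x ↦ g (ε⁻¹ • x)) q
  have h2 := Measure.integral_comp_inv_smul_of_nonneg (volume : Measure R3) g hε.le
  simp only [rescale]
  rw [h1, h2]
  simp

theorem memLp_comp_rescale {ε : ℝ} (hε : 0 < ε) (q : R3) {g : R3 → ℂ} (hg : MemLp g 2 volume) :
    MemLp (fun x ↦ g (rescale ε q x)) 2 volume := by
  have h : MemLp g 2 (Measure.map (rescale ε q) volume) := by
    rw [map_rescale hε]
    exact hg.smul_measure ENNReal.ofReal_ne_top
  exact h.comp_of_map (measurable_rescale ε q).aemeasurable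

namespace SchwartzMap

/-- The Schwartz function `y ↦ φ (ε y + q)`. -/
noncomputable def dilate {ε : ℝ} (hε : 0 < ε) (q : R3) (φ : 𝓢(R3, ℂ)) : 𝓢(R3, ℂ) :=
  compCLMOfContinuousLinearEquiv ℂ
    (ContinuousLinearEquiv.smulLeft (M₁ := R3) (R₁ := ℝ) (Units.mk0 ε hε.ne')) (compSubConstCLM ℂ (-q) φ)

variable {ε : ℝ} (hε : 0 < ε) (q : R3) (φ : 𝓢(R3, ℂ))

theorem dilate_apply (y : R3) : dilate hε q φ y = φ (ε • y + q) := by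
  simp [dilate]

theorem lineDerivOp_dilate (v : R3) :
    ∂_{v} (dilate hε q φ) = (ε : ℂ) • dilate hε q (∂_{v} φ) := by
  ext y
  have h1 : HasFDerivAt (fun y : R3 ↦ ε • y + q) (ε • ContinuousLinearMap.id ℝ R3) y :=
    ((hasFDerivAt_id y).const_smul ε).add_const q
  have h2 := (φ.hasFDerivAt (ε • y + q)).comp y h1
  have h3 : ⇑(dilate hε q φ) = ⇑φ ∘ fun y : R3 ↦ ε • y + q := by
    ext y; simp [dilate_apply]
  rw [lineDerivOp_apply_eq_fderiv, h3, h2.fderiv]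
  simp [dilate_apply, lineDerivOp_apply_eq_fderiv]

theorem laplacian_dilate (y : R3) :
    (Δ (dilate hε q φ)) y = (ε : ℂ) ^ 2 * (Δ φ) (ε • y + q) := by
  have h (v : R3) : ∂_{v} ((ε : ℂ) • dilate hε q (∂_{v} φ)) = (ε : ℂ) • ∂_{v} (dilate hε q (∂_{v} φ)) :=
    LineDeriv.lineDerivOp_smul _ _ _
  simp only [laplacian_apply_eq, lineDerivOp_dilate, h, smul_apply, dilate_apply, smul_eq_mul]
  ring

theorem helmholtz_eq_dilate (a : ℝ) (x : R3) :
    φ.helmholtz (((1 / ε ^ 2 : ℝ) : ℂ) - Complex.I * ((a / ε : ℝ) : ℂ)) x =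
      ((1 / ε ^ 2 : ℝ) : ℂ) * (dilate hε q φ).helmholtz (1 - Complex.I * ((a * ε : ℝ) : ℂ))
        (rescale ε q x) := by
  have hx : ε • rescale ε q x + q = x := by simp [rescale, smul_smul, hε.ne']
  have hε' : (ε : ℂ) ≠ 0 := by exact_mod_cast hε.ne'
  simp only [helmholtz, add_apply, smul_apply, laplacian_dilate, dilate_apply, hx, smul_eq_mul]
  push_cast
  field_simp

end SchwartzMap

theorem MemB.exists_scaled_solution {S : R3 → ℂ} (hS : MemB S) {ε a : ℝ} (hε : 0 < ε) (ha : 0 < a)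
    (q : R3) :
    ∃ U : Lp ℂ 2 (volume : Measure R3),
      (∀ φ : 𝓢(R3, ℂ), ∫ x,
        φ.helmholtz (((1 / ε ^ 2 : ℝ) : ℂ) - Complex.I * ((a / ε : ℝ) : ℂ)) x * U x
          = ∫ x, φ x * (((1 / ε ^ 3 : ℝ) : ℂ) * S (rescale ε q x))) ∧
      ∀ ρ : ℝ, 0 < ρ → eLpNorm U 2 (volume.restrict (Metric.ball 0 ρ)) ≤
        ENNReal.ofReal √(1240 * (ρ + ‖q‖)) * bNorm S := by
  -- The rescaled absorption is `a ε`, as `ε⁻² (1 - i a ε) = ε⁻² - i a/ε`. The amplitude `ε⁻¹` of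
  -- the solution, times this `ε⁻²`, gives the `ε⁻³` of the source.
  obtain ⟨u, hu, hub⟩ := hS.exists_solution (mul_pos ha hε)
  have hm : MemLp (fun x ↦ ((ε⁻¹ : ℝ) : ℂ) * u (rescale ε q x)) 2 volume :=
    (memLp_comp_rescale hε q (Lp.memLp u)).const_mul _
  have hε' : (ε : ℂ) ≠ 0 := by exact_mod_cast hε.ne'
  refine ⟨hm.toLp _, fun φ ↦ ?_, fun ρ hρ ↦ ?_⟩
  · set ψ := SchwartzMap.dilate hε q φ with hψ
    calc _ = ∫ x, ((1 / ε ^ 3 : ℝ) : ℂ) *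
          (fun y ↦ ψ.helmholtz (1 - Complex.I * ((a * ε : ℝ) : ℂ)) y * u y) (rescale ε q x) := by
          refine integral_congr_ae ?_
          filter_upwards [hm.coeFn_toLp] with x hx
          rw [hx, SchwartzMap.helmholtz_eq_dilate hε q φ a x, ← hψ]
          push_cast
          field_simp
      _ = ∫ x, ((1 / ε ^ 3 : ℝ) : ℂ) * (fun y ↦ ψ y * S y) (rescale ε q x) := by
          have k₁ := integral_comp_rescale hε q
            fun y ↦ ψ.helmholtz (1 - Complex.I * ((a * ε : ℝ) : ℂ)) y * u y
          have k₂ := integral_comp_rescale hε q fun y ↦ ψ y * S y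
          rw [integral_const_mul, integral_const_mul, k₁, k₂, hu ψ]
      _ = _ := by
          refine integral_congr_ae (.of_forall fun x ↦ ?_)
          have hx : ε • rescale ε q x + q = x := by simp [rescale, smul_smul, hε.ne']
          simp only [hψ, SchwartzMap.dilate_apply, hx]
          ring
  · set r : ℝ := (ρ + ‖q‖) / ε with hr
    have hr0 : 0 < r := by positivity
    have hsub : Metric.ball 0 ρ ⊆ rescale ε q ⁻¹' Metric.ball 0 r := by
      intro x hx
      rw [Set.mem_preimage, mem_ball_zero_iff, rescale, norm_smul, norm_inv,
        Real.norm_of_nonneg hε.le, hr, inv_mul_eq_div]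
      gcongr
      exact (norm_sub_le _ _).trans_lt (by gcongr; exact mem_ball_zero_iff.1 hx)
    have hmap : Measure.map (rescale ε q) (volume.restrict (rescale ε q ⁻¹' Metric.ball 0 r))
        = ENNReal.ofReal (ε ^ 3) • (volume.restrict (Metric.ball 0 r)) := by
      rw [← Measure.restrict_map (measurable_rescale ε q) measurableSet_ball, map_rescale hε,
        Measure.restrict_smul]
    rw [eLpNorm_congr_ae (ae_restrict_of_ae hm.coeFn_toLp)]
    calc eLpNorm (fun x ↦ ((ε⁻¹ : ℝ) : ℂ) * u (rescale ε q x)) 2 (volume.restrict (Metric.ball 0 ρ))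
        = ENNReal.ofReal ε⁻¹ *
          eLpNorm (fun x ↦ u (rescale ε q x)) 2 (volume.restrict (Metric.ball 0 ρ)) := by
          have := eLpNorm_const_smul (((ε⁻¹ : ℝ) : ℂ)) (fun x ↦ (u : R3 → ℂ) (rescale ε q x)) 2
            (volume.restrict (Metric.ball 0 ρ))
          rw [← ofReal_norm, Complex.norm_real, Real.norm_of_nonneg (by positivity)] at this
          exact this
      _ ≤ ENNReal.ofReal ε⁻¹ * eLpNorm ((u : R3 → ℂ) ∘ rescale ε q) 2
          (volume.restrict (rescale ε q ⁻¹' Metric.ball 0 r)) := by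
          gcongr
          exact eLpNorm_mono_measure _ (Measure.restrict_mono hsub le_rfl)
      _ = ENNReal.ofReal ε⁻¹ * (ENNReal.ofReal (ε ^ 3) ^ (1 / 2 : ℝ) *
          eLpNorm u 2 (volume.restrict (Metric.ball 0 r))) := by
          rw [← eLpNorm_map_measure ?_ (measurable_rescale ε q).aemeasurable, hmap,
            eLpNorm_smul_measure_of_ne_top (by norm_num)]
          · norm_num
          · rw [hmap]
            exact (Lp.aestronglyMeasurable u).restrict.smul_measure _
      _ ≤ ENNReal.ofReal ε⁻¹ * (ENNReal.ofReal (ε ^ 3) ^ (1 / 2 : ℝ) *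
          (ENNReal.ofReal √(1240 * r) * bNorm S)) := by
          gcongr
          exact hub r hr0
      -- The powers of `ε` cancel: `ε⁻¹` from the amplitude, `ε^(3/2)` from the Jacobian, `ε^(-1/2)`
      -- from the radius.
      _ = ENNReal.ofReal √(1240 * (ρ + ‖q‖)) * bNorm S := by
          rw [ENNReal.ofReal_rpow_of_nonneg (by positivity) (by norm_num), ← mul_assoc, ← mul_assoc,
            ← ENNReal.ofReal_mul (by positivity), ← ENNReal.ofReal_mul (by positivity),
            ← Real.sqrt_eq_rpow]
          congr 2
          have h1 : ε⁻¹ = √((ε⁻¹) ^ 2) := (Real.sqrt_sq (by positivity)).symm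
          conv_lhs => rw [h1]
          rw [← Real.sqrt_mul (by positivity), ← Real.sqrt_mul (by positivity), hr]
          congr 1
          field_simp

/-! ### From balls to the `B*` norm, and conclusion -/

theorem bStarNorm_le_of_eLpNorm_ball_le {u : R3 → ℂ} {D : ℝ} {M : ℝ≥0∞}
    (h : ∀ k : ℕ, eLpNorm u 2 (volume.restrict (Metric.ball 0 (2 ^ k))) ≤
      ENNReal.ofReal √(2 ^ k * D) * M) :
    bStarNorm u ≤ ENNReal.ofReal √(2 * D) * M := by
  refine iSup_le fun k ↦ ?_
  rw [ENNReal.mul_rpow_of_nonneg _ _ (by norm_num), ← eLpNorm_two_eq]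
  -- The shift `k = j + 1` is the source of the factor `2` in `√(2 * D)`.
  have h2 : (2 : ℝ≥0∞) ^ (1 - (k : ℤ)) = ENNReal.ofReal (2 * (2 ^ k)⁻¹) := by
    rw [ENNReal.zpow_sub (by norm_num) (by norm_num), ENNReal.ofReal_mul (by norm_num),
      ENNReal.ofReal_inv_of_pos (by positivity), ENNReal.ofReal_pow (by norm_num)]
    norm_num
  rw [h2, ENNReal.ofReal_rpow_of_nonneg (by positivity) (by norm_num), ← Real.sqrt_eq_rpow]
  calc _ ≤ ENNReal.ofReal √(2 * (2 ^ k)⁻¹) * (ENNReal.ofReal √(2 ^ k * D) * M) := by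
        gcongr
        exact (eLpNorm_mono_measure _ (Measure.restrict_mono (dyadicRing_subset_ball k) le_rfl)).trans
          (h k)
    _ = ENNReal.ofReal √(2 * D) * M := by
        rw [← mul_assoc, ← ENNReal.ofReal_mul (by positivity), ← Real.sqrt_mul (by positivity)]
        congr 3
        field_simp

theorem proposition3p1 (q₁ : R3) (hq₁ : q₁ ≠ 0) :
    ∃ C : ℝ≥0, ∀ α : ℝ → ℝ, (∀ ε, 0 < ε → 0 < α ε) →
      ∀ S₀ S₁ : R3 → ℂ, MemB S₀ → MemB S₁ → ∀ ε : ℝ, 0 < ε →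
        (∃! u : Lp ℂ 2 (volume : Measure R3),
          IsHelmholtzSolution ε (α ε) (twoPointSource S₀ S₁ q₁ ε) u) ∧
        ∀ u : Lp ℂ 2 (volume : Measure R3),
          IsHelmholtzSolution ε (α ε) (twoPointSource S₀ S₁ q₁ ε) u →
            bStarNorm u ≤ C * (bNorm S₀ + bNorm S₁) := by
  set D : ℝ := 1240 * (1 + ‖q₁‖) with hD
  refine ⟨Real.toNNReal √(2 * D), fun α hα S₀ S₁ hS₀ hS₁ ε hε ↦ ?_⟩
  have ha := hα ε hε
  obtain ⟨U₀, hU₀, hb₀⟩ := hS₀.exists_scaled_solution hε ha 0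
  obtain ⟨U₁, hU₁, hb₁⟩ := hS₁.exists_scaled_solution hε ha q₁
  have hz : (((1 / ε ^ 2 : ℝ) : ℂ) - Complex.I * ((α ε / ε : ℝ) : ℂ)).im ≠ 0 := by
    rw [Complex.sub_im, Complex.ofReal_im, Complex.I_mul_im, Complex.ofReal_re]
    have : 0 < α ε / ε := by positivity
    linarith
  have hsol : IsHelmholtzSolution ε (α ε) (twoPointSource S₀ S₁ q₁ ε) (U₀ + U₁) := by
    refine isHelmholtzSolution_iff.2 fun φ ↦ ?_
    have hint (S : R3 → ℂ) (hS : MemB S) (q : R3) :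
        Integrable fun x ↦ φ x * (((1 / ε ^ 3 : ℝ) : ℂ) * S (rescale ε q x)) :=
      (φ.memLp 2).integrable_mul ((memLp_comp_rescale hε q hS.memLp).const_mul _)
    have e1 : ∫ x, φ x * twoPointSource S₀ S₁ q₁ ε x =
        (∫ x, φ x * (((1 / ε ^ 3 : ℝ) : ℂ) * S₀ (rescale ε 0 x)))
          + ∫ x, φ x * (((1 / ε ^ 3 : ℝ) : ℂ) * S₁ (rescale ε q₁ x)) := by
      rw [← integral_add (hint S₀ hS₀ 0) (hint S₁ hS₁ q₁)]
      refine integral_congr_ae (.of_forall fun x ↦ ?_)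
      simp [twoPointSource, rescale, mul_add]
    rw [e1, ← hU₀ φ, ← hU₁ φ]
    set ψ := φ.helmholtz (((1 / ε ^ 2 : ℝ) : ℂ) - Complex.I * ((α ε / ε : ℝ) : ℂ))
    have hi (U : Lp ℂ 2 (volume : Measure R3)) : Integrable fun x ↦ ψ x * U x :=
      (ψ.memLp 2).integrable_mul (Lp.memLp U)
    rw [← integral_add (hi U₀) (hi U₁)]
    refine integral_congr_ae ?_
    filter_upwards [Lp.coeFn_add U₀ U₁] with x hx
    rw [hx, Pi.add_apply, mul_add]
  have huniq (u : Lp ℂ 2 (volume : Measure R3))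
      (hu : IsHelmholtzSolution ε (α ε) (twoPointSource S₀ S₁ q₁ ε) u) : u = U₀ + U₁ :=
    Lp_ext_of_integral_helmholtz_eq hz fun φ ↦ by
      rw [isHelmholtzSolution_iff.1 hu φ, isHelmholtzSolution_iff.1 hsol φ]
  refine ⟨⟨U₀ + U₁, hsol, huniq⟩, fun u hu ↦ ?_⟩
  rw [huniq u hu]
  refine bStarNorm_le_of_eLpNorm_ball_le fun k ↦ ?_
  have hk : (1 : ℝ) ≤ 2 ^ k := one_le_pow₀ one_le_two
  -- The offset `‖q‖` is absorbed because `2^k ≥ 1`; this is the only dependence of the constant on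
  -- `q₁`.
  have hbound (q : R3) (hq : ‖q‖ ≤ ‖q₁‖) : √(1240 * (2 ^ k + ‖q‖)) ≤ √(2 ^ k * D) := by
    refine Real.sqrt_le_sqrt ?_
    rw [hD]
    nlinarith [norm_nonneg q₁]
  rw [eLpNorm_congr_ae (ae_restrict_of_ae (Lp.coeFn_add U₀ U₁)), mul_add]
  refine (eLpNorm_add_le (Lp.aestronglyMeasurable _).restrict (Lp.aestronglyMeasurable _).restrict
    (by norm_num)).trans (add_le_add ((hb₀ _ (by positivity)).trans ?_)
      ((hb₁ _ (by positivity)).trans ?_))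
  · exact mul_le_mul_left (ENNReal.ofReal_le_ofReal (hbound 0 (by simp))) _
  · exact mul_le_mul_left (ENNReal.ofReal_le_ofReal (hbound q₁ le_rfl)) _
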